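/- Let $H$ be an infinite-dimensional complex Hilbert space, $L$ a self-adjoint, strictly positive operator in $H$ with compact resolvent, and $0<\alpha<\beta$. Then $H$ has an orthonormal basis $(\phi_n)_{n\in\mathbb N}$ of eigenvectors of $L$; let $(\phi_n)$ be any such basis, $L\phi_n=\mu_n\phi_n$. Consider $$\frac{dU}{dt}=AU,\qquad A(u,v,w)=\Bigl(v,\;w,\;-\tfrac1\alpha L(u+\beta v)-\tfrac1\alpha w\Bigr),$$ the first order form of $(u+\alpha u_t)_{tt}+L(u+\beta u_t)=0$, in any one of the four spaces $\mathcal H_i$ $$D(L^{1/2})\times D(L^{1/2})\times H,\quad D(L)\times D(L)\times D(L^{1/2}),\quad D(L)\times D(L^{1/2})\times H,\quad D(L^{3/2})\times D(L)\times D(L^{1/2}),$$ normed by $\|(u,v,w)\|^2=\|L^{a}u\|^2+\|L^{b}v\|^2+\|L^{c}w\|^2$ for $\mathcal H_i=D(L^a)\times D(L^b)\times D(L^c)$, with $D(A)=\{U\in\mathcal H_i:\ u+\beta v\in D(L),\ AU\in\mathcal H_i\}$. Solutions are mild solutions on $[0,\infty)$ with arbitrary $U(0)\in\mathcal H_i$,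 or classical ones. Let $$\sigma_{\max}=\sup\{\operatorname{Re}\lambda:\ \alpha\lambda^3+\lambda^2+\beta\mu_n\lambda+\mu_n=0\text{ for some }n\},$$ and let $$m_{1,2}=\alpha\,\frac{-C_1\mp\sqrt{C_2}}{8\beta^3},\qquad C_1=27-18\frac\beta\alpha-\Bigl(\frac\beta\alpha\Bigr)^2,\quad C_2=C_1^2-64\Bigl(\frac\beta\alpha\Bigr)^3$$ (complex numbers, non-real if $C_2<0$). For each $n$ let $\lambda^n_1,\lambda^n_2,\lambda^n_3$ be the roots, with multiplicity, of the above cubic, $\Psi^n_j=(1,\lambda^n_j,(\lambda^n_j)^2)^T/c^n_j$, where $c^n_j>0$ is the norm of $(\phi_n,\lambda^n_j\phi_n,(\lambda^n_j)^2\phi_n)$ in $\mathcal H_i$, and let $C_n$ be the matrix with columns $\Psi^n_1,\Psi^n_2,\Psi^n_3$. If all $C_n$ are invertible, let $\langle\cdot,\cdot\rangle_{G}$ be the block diagonal form on $\mathcal H_i$ whose block on $\operatorname{span}\{(\phi_n,0,0),(0,\phi_n,0),(0,0,\phi_n)\}$ has the matrix $(C_n^{-1})^*C_n^{-1}$. Then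 $\sigma_{\max}$ is finite and $\sigma_{\max}<0$, and the following holds in each of the four spaces. (i) Suppose $\mu_n\neq m_1,m_2$ for all $n$. Then $\langle\cdot,\cdot\rangle_G$ is a scalar product on $\mathcal H_i$ whose norm is equivalent to the natural one, $A$ is a normal operator with respect to it, and every solution satisfies $$\|U(t)\|_G\le e^{\sigma_{\max}t}\|U(0)\|_G\qquad(t\ge0).$$ (ii) In the situation of (i) the rate is optimal: for every $\omega<\sigma_{\max}$ there is a solution with $\|U(t)\|_G\,e^{-\omega t}\to\infty$ as $t\to\infty$. (iii) Suppose $\mu_n\in\{m_1,m_2\}$ for some $n$. Then $A$ is not normal with respect to any scalar product on $\mathcal H_i$, but there is a scalar product on $\mathcal H_i$ whose norm $\|\cdot\|_{G'}$ is equivalent to the natural one and for which (i) and (ii) still hold: every solution satisfies $\|U(t)\|_{G'}\le e^{\sigma_{\max}t}\|U(0)\|_{G'}$ for $t\ge0$, and for every $\omega<\sigma_{\max}$ there is a solution with $\|U(t)\|_{G'}\,e^{-\omega t}\to\infty$ as $t\to\infty$. -/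

import Mathlib

open Filter Topology
open scoped Matrix InnerProductSpace

namespace MGT

noncomputable section

/-! ### The operator `L` -/

/-- `L` has compact resolvent: for some `z` the operator `L - z` is a bijection of `D(L)` onto `H`
whose inverse `R` is a compact operator on `H`. -/
def HasCompactResolvent {H : Type*} [NormedAddCommGroup H] [InnerProductSpace ℂ H]
    (L : H →ₗ.[ℂ] H) : Prop :=
  ∃ (z : ℂ) (R : H →L[ℂ] H), IsCompactOperator R ∧
    (∀ y : H, ∃ h : R y ∈ L.domain, L ⟨R y, h⟩ - z • R y = y) ∧
    (∀ x : L.domain, R (L x - z • (x : H)) = x)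

/-- `L` is strictly positive: `⟪L x, x⟫ > 0` for every nonzero `x` in its domain. -/
def IsStrictlyPositive {H : Type*} [NormedAddCommGroup H] [InnerProductSpace ℂ H]
    (L : H →ₗ.[ℂ] H) : Prop :=
  ∀ x : L.domain, (x : H) ≠ 0 → 0 < (⟪L x, (x : H)⟫_ℂ).re

/-- `φ` is an orthonormal basis of `H` of eigenvectors of `L`, `L φₙ = μₙ φₙ`
(each eigenvalue is repeated according to its multiplicity; no order is imposed). -/
def IsEigenbasis {H : Type*} [NormedAddCommGroup H] [InnerProductSpace ℂ H]
    (L : H →ₗ.[ℂ] H) (φ : HilbertBasis ℕ ℂ H) (μ : ℕ → ℝ) : Prop :=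
  ∀ n, ∃ h : φ n ∈ L.domain, L ⟨φ n, h⟩ = (μ n : ℂ) • φ n

/-! ### The characteristic equation -/

/-- `α X³ + X² + β m X + m`. -/
def charPoly (α β m : ℝ) : Polynomial ℂ :=
  Polynomial.C (α : ℂ) * Polynomial.X ^ 3 + Polynomial.X ^ 2
    + Polynomial.C ((β * m : ℝ) : ℂ) * Polynomial.X + Polynomial.C (m : ℂ)

/-- The three roots of the characteristic polynomial, listed with multiplicity (in some order). -/
def charRoot (α β m : ℝ) (j : Fin 3) : ℂ :=
  (charPoly α β m).roots.toList.getD j 0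

/-- The real parts of all solutions, for all `n`, of
`α λ³ + λ² + β μₙ λ + μₙ = 0`. -/
def realParts (μ : ℕ → ℝ) (α β : ℝ) : Set ℝ :=
  {x | ∃ (n : ℕ) (z : ℂ), (α : ℂ) * z ^ 3 + z ^ 2 + β * μ n * z + μ n = 0 ∧ x = z.re}

/-- The supremum of these real parts. -/
def sigmaMax (μ : ℕ → ℝ) (α β : ℝ) : ℝ := sSup (realParts μ α β)

/-- `C₁ = 27 - 18 (β/α) - (β/α)²`. -/
def C₁ (α β : ℝ) : ℝ := 27 - 18 * (β / α) - (β / α) ^ 2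

/-- `C₂ = C₁² - 64 (β/α)³`. -/
def C₂ (α β : ℝ) : ℝ := C₁ α β ^ 2 - 64 * (β / α) ^ 3

/-- `m₁ = α (-C₁ - √C₂) / (8 β³)`, a complex number (not real if `C₂ < 0`). -/
def m₁ (α β : ℝ) : ℂ :=
  α * (-(C₁ α β : ℂ) - Complex.sqrt (C₂ α β : ℂ)) / (8 * (β : ℂ) ^ 3)

/-- `m₂ = α (-C₁ + √C₂) / (8 β³)`, a complex number (not real if `C₂ < 0`). -/
def m₂ (α β : ℝ) : ℂ :=
  α * (-(C₁ α β : ℂ) + Complex.sqrt (C₂ α β : ℂ)) / (8 * (β : ℂ) ^ 3)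

/-- No eigenvalue of `L` equals `m₁` or `m₂`. -/
def NonExceptional (μ : ℕ → ℝ) (α β : ℝ) : Prop :=
  ∀ n, (μ n : ℂ) ≠ m₁ α β ∧ (μ n : ℂ) ≠ m₂ α β

/-! ### The four functional settings -/

/-- The four settings are `D(L^{k₀/2}) × D(L^{k₁/2}) × D(L^{k₂/2})` with these `(k₀, k₁, k₂)`. -/
def halfExp (i : Fin 4) : Fin 3 → ℕ :=
  ![![1, 1, 0], ![2, 2, 1], ![2, 1, 0], ![3, 2, 1]] i

/-- `D(L^{k/2})`: the `u` for which `(μₙ^{k/2} ⟪φₙ, u⟫)ₙ` is square summable. -/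
def halfPowDomain {H : Type*} [NormedAddCommGroup H] [InnerProductSpace ℂ H]
    (φ : HilbertBasis ℕ ℂ H) (μ : ℕ → ℝ) (k : ℕ) : Submodule ℂ H where
  carrier := {u | Memℓp (fun n => ((√(μ n) : ℝ) : ℂ) ^ k * ⟪φ n, u⟫_ℂ) 2}
  zero_mem' := by
    simpa using (zero_mem_ℓp' : Memℓp (fun _ : ℕ => (0 : ℂ)) 2)
  add_mem' := by
    intro a b ha hb
    have h := Memℓp.add ha hb
    refine (congrArg (fun f : ℕ → ℂ => Memℓp f 2) (funext fun n => ?_)).mp h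
    simp [mul_add]
  smul_mem' := by
    intro c a ha
    have h := Memℓp.const_smul ha c
    refine (congrArg (fun f : ℕ → ℂ => Memℓp f 2) (funext fun n => ?_)).mp h
    simp [mul_left_comm]

/-- The phase space `𝓗ᵢ`, a space of triples `U = (u, v, w)`. -/
def phaseSpace {H : Type*} [NormedAddCommGroup H] [InnerProductSpace ℂ H]
    (φ : HilbertBasis ℕ ℂ H) (μ : ℕ → ℝ) (i : Fin 4) : Submodule ℂ (Fin 3 → H) :=
  Submodule.pi Set.univ fun r => halfPowDomain φ μ (halfExp i r)

variable {H : Type*} [NormedAddCommGroup H] [InnerProductSpace ℂ H]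
  {φ : HilbertBasis ℕ ℂ H} {μ : ℕ → ℝ} {i : Fin 4}

/-- The component `r` (`0`, `1`, `2` for `u`, `v`, `w`) of an element of the phase space. -/
def comp (U : phaseSpace φ μ i) (r : Fin 3) : H := (U : Fin 3 → H) r

/-- The coordinates of `U` in the basis `(φₙ,0,0), (0,φₙ,0), (0,0,φₙ)` of `Eₙ`. -/
def coord (U : phaseSpace φ μ i) (n : ℕ) : Fin 3 → ℂ := fun r => ⟪φ n, comp U r⟫_ℂ

/-- The square of the natural norm of `𝓗ᵢ`:
`‖L^{k₀/2} u‖² + ‖L^{k₁/2} v‖² + ‖L^{k₂/2} w‖²`. -/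
def natNormSq (U : phaseSpace φ μ i) : ℝ :=
  ∑' n, ∑ r, μ n ^ halfExp i r * ‖coord U n r‖ ^ 2

/-- The natural norm of `𝓗ᵢ`. -/
def natNorm (U : phaseSpace φ μ i) : ℝ := √(natNormSq U)

/-! ### Scalar products on the phase space -/

/-- `g` is a scalar product (conjugate linear in the first variable). -/
structure IsScalarProduct (g : phaseSpace φ μ i → phaseSpace φ μ i → ℂ) : Prop where
  add_right : ∀ U V W, g U (V + W) = g U V + g U W
  smul_right : ∀ (c : ℂ) (U V), g U (c • V) = c * g U V
  conj_symm : ∀ U V, (starRingEnd ℂ) (g V U) = g U V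
  pos : ∀ U, U ≠ 0 → 0 < (g U U).re

/-- The norm `‖U‖_g = √⟨U, U⟩_g`. -/
def gNorm (g : phaseSpace φ μ i → phaseSpace φ μ i → ℂ) (U : phaseSpace φ μ i) : ℝ :=
  √((g U U).re)

/-- The norm of `g` is equivalent to the natural norm of `𝓗ᵢ`. -/
def IsEquivalent (g : phaseSpace φ μ i → phaseSpace φ μ i → ℂ) : Prop :=
  ∃ c C : ℝ, 0 < c ∧ 0 < C ∧ ∀ U, c * natNorm U ≤ gNorm g U ∧ gNorm g U ≤ C * natNorm U

/-- The normalizing constant of the eigenvector `(1, λ, λ²)` of the block of `A` on `Eₙ`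
(with `m = μₙ`): its natural norm in `𝓗ᵢ`. -/
def eigNorm (i : Fin 4) (m : ℝ) (l : ℂ) : ℝ := √(∑ r : Fin 3, m ^ halfExp i r * ‖l ^ (r : ℕ)‖ ^ 2)

/-- The matrix whose columns are the normalized eigenvectors `Ψⱼ = (1, λⱼ, λⱼ²) / cⱼ`. -/
def eigMatrix (α β : ℝ) (i : Fin 4) (m : ℝ) : Matrix (Fin 3) (Fin 3) ℂ :=
  Matrix.of fun r j => charRoot α β m j ^ (r : ℕ) / (eigNorm i m (charRoot α β m j) : ℂ)

/-- The matrix `(C⁻¹)ᴴ C⁻¹` of the new scalar product on `Eₙ`. -/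
def blockG (α β : ℝ) (i : Fin 4) (m : ℝ) : Matrix (Fin 3) (Fin 3) ℂ :=
  (eigMatrix α β i m)⁻¹ᴴ * (eigMatrix α β i m)⁻¹

/-- The new scalar product `⟨·,·⟩_{Gᵢ}` on `𝓗ᵢ`, block diagonal with the blocks `blockG`. -/
def prodG (α β : ℝ) (U V : phaseSpace φ μ i) : ℂ :=
  ∑' n, star (coord U n) ⬝ᵥ (blockG α β i (μ n) *ᵥ coord V n)

/-! ### The generator `A` and the evolution equation -/

/-- The graph of `A` in `𝓗ᵢ`: `GenRel L α β U V` says that `U = (u, v, w) ∈ D(A)` and `A U = V`, with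
`A U = (v, w, -(1/α) L (u + β v) - (1/α) w)` and
`D(A) = {U ∈ 𝓗ᵢ | u + β v ∈ D(L), A U ∈ 𝓗ᵢ}`. -/
def GenRel (L : H →ₗ.[ℂ] H) (α β : ℝ) (U V : phaseSpace φ μ i) : Prop :=
  comp V 0 = comp U 1 ∧ comp V 1 = comp U 2 ∧
    ∃ h : comp U 0 + (β : ℂ) • comp U 1 ∈ L.domain,
      comp V 2 = -((1 / α : ℝ) : ℂ) • L ⟨comp U 0 + (β : ℂ) • comp U 1, h⟩
        - ((1 / α : ℝ) : ℂ) • comp U 2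

/-- The graph of the adjoint of `A` with respect to `g`:
`Y ∈ D(A*)`, `A* Y = Z`, that is, `⟨Y, A U⟩_g = ⟨Z, U⟩_g` for all `U ∈ D(A)`. -/
def AdjRel (L : H →ₗ.[ℂ] H) (α β : ℝ) (g : phaseSpace φ μ i → phaseSpace φ μ i → ℂ)
    (Y Z : phaseSpace φ μ i) : Prop :=
  ∀ U V, GenRel L α β U V → g Y V = g Z U

/-- `A` is a normal operator with respect to `g`: it is densely defined, `D(A) = D(A*)`, and
`‖A Y‖_g = ‖A* Y‖_g` on this domain. -/
def IsNormal (L : H →ₗ.[ℂ] H) (α β : ℝ) (g : phaseSpace φ μ i → phaseSpace φ μ i → ℂ) : Prop :=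
  (∀ U, ∀ ε > 0, ∃ V W, GenRel L α β V W ∧ gNorm g (U - V) < ε) ∧
  (∀ Y, (∃ V, GenRel L α β Y V) ↔ ∃ Z, AdjRel L α β g Y Z) ∧
  (∀ Y V Z, GenRel L α β Y V → AdjRel L α β g Y Z → gNorm g V = gNorm g Z)

/-- `U` is continuous from `[0, ∞)` to `𝓗ᵢ`. -/
def ContinuousPath (U : ℝ → phaseSpace φ μ i) : Prop :=
  ∀ t₀ ≥ 0, Tendsto (fun t => natNorm (U t - U t₀)) (𝓝[Set.Ici 0] t₀) (𝓝 0)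

/-- `U` is a (mild) solution on `[0, ∞)` of `dU/dt = A U` in `𝓗ᵢ`: it is continuous into `𝓗ᵢ` and
`∫₀ᵗ U ∈ D(A)`, `U(t) = U(0) + A ∫₀ᵗ U` for all `t ≥ 0`. These are the orbits `e^{tA} U(0)` with an
arbitrary `U(0) ∈ 𝓗ᵢ`; they include the classical solutions. The integral of the continuous
`𝓗ᵢ`-valued function is computed componentwise in `H`, where `𝓗ᵢ` embeds continuously. -/
def IsSolution (L : H →ₗ.[ℂ] H) (α β : ℝ) (U : ℝ → phaseSpace φ μ i) : Prop :=
  ContinuousPath U ∧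
  ∀ t ≥ 0, ∃ V : phaseSpace φ μ i,
    (∀ r, comp V r = ∫ s in (0 : ℝ)..t, comp (U s) r) ∧ GenRel L α β V (U t - U 0)

/-- `U` is a classical solution on `[0, ∞)` of `dU/dt = A U` in `𝓗ᵢ`: `U(t) ∈ D(A)` for all `t ≥ 0`,
and `U` is continuously differentiable into `𝓗ᵢ` with derivative `A U`. -/
def IsClassicalSolution (L : H →ₗ.[ℂ] H) (α β : ℝ) (U : ℝ → phaseSpace φ μ i) : Prop :=
  ∃ V : ℝ → phaseSpace φ μ i, ContinuousPath V ∧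
    ∀ t ≥ 0, GenRel L α β (U t) (V t) ∧
      Tendsto (fun s => natNorm (((s - t : ℝ) : ℂ)⁻¹ • (U s - U t) - V t))
        (𝓝[Set.Ici 0 \ {t}] t) (𝓝 0)

/-- Every solution satisfies `‖U(t)‖_g ≤ e^{σ t} ‖U(0)‖_g` for `t ≥ 0`, where `σ = σ_max`. -/
def DecayEstimate (L : H →ₗ.[ℂ] H) (α β : ℝ)
    (g : phaseSpace φ μ i → phaseSpace φ μ i → ℂ) : Prop :=
  ∀ U : ℝ → phaseSpace φ μ i, (IsSolution L α β U ∨ IsClassicalSolution L α β U) →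
    ∀ t ≥ 0, gNorm g (U t) ≤ Real.exp (sigmaMax μ α β * t) * gNorm g (U 0)

/-- For every `ω < σ_max` some solution, even a classical one, satisfies
`‖U(t)‖_g e^{-ω t} → ∞` as `t → ∞`. -/
def DecayOptimal (L : H →ₗ.[ℂ] H) (α β : ℝ)
    (g : phaseSpace φ μ i → phaseSpace φ μ i → ℂ) : Prop :=
  ∀ ω < sigmaMax μ α β, ∃ U : ℝ → phaseSpace φ μ i,
    IsSolution L α β U ∧ IsClassicalSolution L α β U ∧
      Tendsto (fun t => gNorm g (U t) * Real.exp (-ω * t)) atTop atTop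

end

end MGT

/-! ### Compact operators and orthonormal families of eigenvectors -/

/-! In the basis `φ` the equation decouples: on each three-dimensional `Eₙ` the generator is the
companion matrix `genMatrix` of the cubic with `m = μₙ` (`genRel_iff`). Its eigenvectors are `(1, λ,
λ²)`, so it is diagonalizable exactly when the cubic has simple roots. The discriminant of the cubic
is `-m` times a quadratic in `m` with roots `m₁`, `m₂`, whence the exceptional values. If no `μₙ` is
exceptional, the coordinates `Cₙ⁻¹ x` turn `A` into multiplication by diagonal matrices on `ℓ²(ℂ³)`;
normality and the decay rate are then evident.

The analytic point is that this change of coordinates is bounded in both directions uniformly in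
`n`. Normalized columns bound `Cₙ`; its inverse is bounded through the adjugate once the weighted
determinant stays away from `0`. That determinant compares the Vandermonde determinant, of size
`m^{3/2}`, with the norms of the eigenvectors; these are estimated by `|λ|² = O(m)` for all roots
and `|λ| ≤ 3/β` for one of them (`exists_prod_eigNorm_le`).

Negativity of `σ_max`: real roots lie left of `-1/β`, and Vieta's formula expresses the real part of
a nonreal pair through the remaining real root (`root_re_le`).

In the exceptional case a Jordan chain of length two excludes normality for every scalar product.
The bound survives because only finitely many blocks are affected, and a multiple root forces all
three roots to be real, hence strictly left of `-1/β ≤ σ_max`. The strict gap leaves room for a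
triangular form with small off-diagonal entries. Optimality comes from the exponential solutions
`e^{zt} E`. -/

/-- For an orthonormal family of eigenvectors of a compact operator, only finitely many of the
eigenvalues have modulus at least `c > 0`. -/
theorem Orthonormal.finite_setOf_le_norm_eigenvalue {ι H : Type*} [NormedAddCommGroup H]
    [InnerProductSpace ℂ H] {v : ι → H} (hv : Orthonormal ℂ v) {R : H →L[ℂ] H}
    (hR : IsCompactOperator R) {a : ι → ℂ} (ha : ∀ i, R (v i) = a i • v i) {c : ℝ} (hc : 0 < c) :
    {i | c ≤ ‖a i‖}.Finite := by
  by_contra hinf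
  let f := Set.Infinite.natEmbedding _ hinf
  obtain ⟨K, hK, hRK⟩ := IsCompactOperator.image_closedBall_subset_compact
    (f := (R : H →ₗ[ℂ] H)) hR 1
  have hmem : ∀ n, R (v (f n)) ∈ K := fun n =>
    hRK ⟨v (f n), by simp [hv.1], rfl⟩
  obtain ⟨y, -, ψ, hψ, hy⟩ := hK.tendsto_subseq hmem
  obtain ⟨N, hN⟩ := Metric.cauchySeq_iff'.1 hy.cauchySeq c hc
  have h1 := hN (N + 1) (Nat.le_succ N)
  simp only [Function.comp_apply, dist_eq_norm, ha] at h1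
  set p : ι := (f (ψ (N + 1)) : ι)
  set q : ι := (f (ψ N) : ι)
  have hpq : p ≠ q := by
    intro h
    have := hψ.injective (f.injective (Subtype.ext h))
    omega
  have hp : c ≤ ‖a p‖ := (f (ψ (N + 1))).2
  -- By Pythagoras the images of distinct members are at distance at least `c`, so no subsequence of
  -- them converges.
  have h2 : ‖a p • v p - a q • v q‖ ^ 2 = ‖a p‖ ^ 2 + ‖a q‖ ^ 2 := by
    rw [@norm_sub_sq ℂ]
    simp [inner_smul_left, inner_smul_right, hv.2 hpq, norm_smul, hv.1]
  have h3 : ‖a p • v p - a q • v q‖ ^ 2 < c ^ 2 := by gcongr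
  nlinarith [norm_nonneg (a q), norm_nonneg (a p)]

/-- A compact symmetric operator has a Hilbert basis of eigenvectors. -/
theorem IsCompactOperator.exists_hilbertBasis_eigenvectors.{u} {H : Type u} [NormedAddCommGroup H]
    [InnerProductSpace ℂ H] [CompleteSpace H] {T : H →L[ℂ] H} (hT : IsCompactOperator T)
    (hsymm : (T : H →ₗ[ℂ] H).IsSymmetric) :
    ∃ (ι : Type u) (b : HilbertBasis ι ℂ H) (a : ι → ℂ), ∀ i, T (b i) = a i • b i := by
  have hclosed : ∀ τ : ℂ, IsClosed (Module.End.eigenspace (T : Module.End ℂ H) τ : Set H) := by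
    intro τ
    have : (Module.End.eigenspace (T : Module.End ℂ H) τ : Set H) = {x | T x = τ • x} := by
      ext x
      simp
    rw [this]
    exact isClosed_eq T.continuous (continuous_const_smul τ)
  have hcomplete : ∀ τ : ℂ, CompleteSpace (Module.End.eigenspace (T : Module.End ℂ H) τ) :=
    fun τ => (hclosed τ).completeSpace_coe
  -- `τ` runs over all of `ℂ`; if it is not an eigenvalue, the eigenspace is trivial and contributes
  -- no vectors.
  choose w b hb using fun τ : ℂ => exists_hilbertBasis ℂ
    (Module.End.eigenspace (T : Module.End ℂ H) τ)
  have horth := hsymm.orthogonalFamily_eigenspaces.orthonormal_sigma_orthonormal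
    (fun τ => (b τ).orthonormal)
  refine ⟨Σ τ, w τ, HilbertBasis.mkOfOrthogonalEqBot horth ?_, fun p => p.1, ?_⟩
  · rw [eq_bot_iff, ← ContinuousLinearMap.orthogonalComplement_iSup_eigenspaces_eq_bot hT hsymm]
    intro x hx
    rw [Submodule.mem_orthogonal'] at hx
    rw [← Submodule.iInf_orthogonal, Submodule.mem_iInf]
    intro τ
    rw [Submodule.mem_orthogonal']
    intro y hy
    have h1 := ((b τ).hasSum_repr ⟨y, hy⟩).mapL
      ((innerSL ℂ x).comp (Module.End.eigenspace (T : Module.End ℂ H) τ).subtypeL)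
    refine HasSum.unique h1 ?_
    convert hasSum_zero using 2 with k
    have h2 := hx _ (Submodule.subset_span ⟨⟨τ, k⟩, rfl⟩)
    simp only [Submodule.coe_subtypeₗᵢ, Submodule.subtype_apply] at h2
    simp [h2]
  · intro p
    rw [HilbertBasis.coe_mkOfOrthogonalEqBot]
    exact Module.End.mem_eigenspace_iff.1 (b p.1 p.2).2

namespace MGT

variable {H : Type*} [NormedAddCommGroup H] [InnerProductSpace ℂ H]

/-! ### The operator `L` -/

theorem inner_apply_left_of_isSelfAdjoint [CompleteSpace H] {L : H →ₗ.[ℂ] H}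
    (hself : IsSelfAdjoint L) (x y : L.domain) : ⟪L x, (y : H)⟫_ℂ = ⟪(x : H), L y⟫_ℂ := by
  have h := L.adjoint_isFormalAdjoint hself.dense_domain
  rw [LinearPMap.isSelfAdjoint_def.1 hself] at h
  exact h x y

/-- The resolvent of `L` at `-1` exists and is compact and symmetric. -/
theorem exists_compact_inverse_add_one [CompleteSpace H] {L : H →ₗ.[ℂ] H}
    (hself : IsSelfAdjoint L) (hpos : IsStrictlyPositive L) (hres : HasCompactResolvent L) :
    ∃ T : H →L[ℂ] H, IsCompactOperator T ∧ (T : H →ₗ[ℂ] H).IsSymmetric ∧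
      ∀ y, ∃ h : T y ∈ L.domain, L ⟨T y, h⟩ + T y = y := by
  obtain ⟨z, R, hR, hR1, -⟩ := hres
  -- Since `(L + 1) R = 1 + (1 + z) R`, the inverse of `L + 1` is `R (1 + (1 + z) R)⁻¹`. A kernel
  -- vector `f` would give `L (R f) = -R f`, against positivity; the Fredholm alternative then
  -- yields invertibility.
  have hinj : ∀ f, f + (1 + z) • R f = 0 → f = 0 := by
    intro f hf
    obtain ⟨h, hL⟩ := hR1 f
    by_cases h0 : R f = 0
    · simpa [h0] using hf
    exfalso
    have h1 : L ⟨R f, h⟩ = - R f := by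
      have : L ⟨R f, h⟩ = f + z • R f := sub_eq_iff_eq_add.1 hL
      rw [this, eq_neg_iff_add_eq_zero, ← hf, add_smul, one_smul]
      abel
    have h2 := hpos ⟨R f, h⟩ h0
    rw [h1, inner_neg_left, Complex.neg_re] at h2
    have h3 : 0 ≤ (⟪R f, R f⟫_ℂ).re := inner_self_nonneg (𝕜 := ℂ)
    linarith
  have hunit : IsUnit (1 + (1 + z) • R : H →L[ℂ] H) := by
    by_cases hz : 1 + z = 0
    · simp [hz]
    have hc : -(1 + z)⁻¹ ≠ 0 := by simpa using hz
    rcases hR.hasEigenvalue_or_mem_resolventSet hc with h | h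
    · exfalso
      obtain ⟨v, hv⟩ := h.exists_hasEigenvector
      have h1 : R v = -(1 + z)⁻¹ • v := hv.apply_eq_smul
      refine hv.2 (hinj v ?_)
      rw [h1, smul_smul]
      field_simp
      simp
    · rw [spectrum.mem_resolventSet_iff] at h
      have h2 := (IsUnit.mk0 (-(1 + z)) (neg_ne_zero.2 hz)).map (algebraMap ℂ (H →L[ℂ] H))
      convert h2.mul h using 1
      ext x
      simp [Algebra.algebraMap_eq_smul_one, smul_sub, smul_smul]
      field_simp
      have h4 : (-z + -1) / (1 + z) = -1 := by
        rw [div_eq_iff hz]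
        ring
      rw [h4]
      module
  obtain ⟨u, hu⟩ := hunit
  let T : H →L[ℂ] H := R.comp (↑u⁻¹ : H →L[ℂ] H)
  have hT : ∀ y, ∃ h : T y ∈ L.domain, L ⟨T y, h⟩ + T y = y := by
    intro y
    obtain ⟨h, hL⟩ := hR1 ((↑u⁻¹ : H →L[ℂ] H) y)
    refine ⟨h, ?_⟩
    have h2 : (u : H →L[ℂ] H) ((↑u⁻¹ : H →L[ℂ] H) y) = y := by
      have := u.mul_inv
      exact DFunLike.congr_fun this y
    rw [hu] at h2
    have h3 : L ⟨T y, h⟩ = (↑u⁻¹ : H →L[ℂ] H) y + z • T y := by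
      rw [← sub_eq_iff_eq_add]; exact hL
    rw [h3]
    refine Eq.trans ?_ h2
    simp only [add_apply, one_apply_eq_self,
      smul_apply, add_smul, one_smul, T, ContinuousLinearMap.comp_apply]
    abel
  refine ⟨T, hR.comp_clm _, ?_, hT⟩
  intro x y
  obtain ⟨hx, hLx⟩ := hT x
  obtain ⟨hy, hLy⟩ := hT y
  have := inner_apply_left_of_isSelfAdjoint hself ⟨T x, hx⟩ ⟨T y, hy⟩
  simp only [ContinuousLinearMap.coe_coe]
  conv_lhs => rw [← hLy]
  conv_rhs => rw [← hLx]
  rw [inner_add_right, inner_add_left, this]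

/-- An eigenvector of `T = (L + 1)⁻¹` for `a` is one of `L` for `a⁻¹ - 1`. Injectivity of `T`
excludes `a = 0`, compactness then makes the family countable, and infinite dimension makes it
infinite, so it can be indexed by `ℕ`. -/
theorem exists_eigenbasis [CompleteSpace H] (hdim : ¬ FiniteDimensional ℂ H) {L : H →ₗ.[ℂ] H}
    (hself : IsSelfAdjoint L) (hpos : IsStrictlyPositive L) (hres : HasCompactResolvent L) :
    ∃ (φ : HilbertBasis ℕ ℂ H) (μ : ℕ → ℝ), IsEigenbasis L φ μ := by
  obtain ⟨T, hT, hsymm, hTL⟩ := exists_compact_inverse_add_one hself hpos hres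
  obtain ⟨ι, b, a, hb⟩ := hT.exists_hilbertBasis_eigenvectors hsymm
  have hT0 : ∀ y, T y = 0 → y = 0 := by
    intro y hy
    obtain ⟨h, hL⟩ := hTL y
    have : (⟨T y, h⟩ : L.domain) = 0 := Subtype.ext hy
    rw [this, LinearPMap.map_zero, hy, add_zero] at hL
    exact hL.symm
  have hb0 : ∀ i, b i ≠ 0 := fun i => b.orthonormal.ne_zero i
  have ha : ∀ i, a i ≠ 0 := by
    intro i h
    refine hb0 i (hT0 _ ?_)
    rw [hb, h, zero_smul]
  have hcount : Countable ι := by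
    rw [← Set.countable_univ_iff]
    have : (Set.univ : Set ι) = ⋃ n : ℕ, {i | 1 / ((n : ℝ) + 1) ≤ ‖a i‖} := by
      ext i
      obtain ⟨n, hn⟩ := exists_nat_one_div_lt (norm_pos_iff.2 (ha i))
      simp only [Set.mem_univ, Set.mem_iUnion, true_iff]
      exact ⟨n, hn.le⟩
    rw [this]
    exact Set.countable_iUnion fun n =>
      (b.orthonormal.finite_setOf_le_norm_eigenvalue hT hb (by positivity)).countable
  have hinf : Infinite ι := by
    by_contra h
    rw [not_infinite_iff_finite] at h
    have := Fintype.ofFinite ι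
    exact hdim b.toOrthonormalBasis.toBasis.finiteDimensional_of_finite
  obtain ⟨e⟩ := nonempty_equiv_of_countable (α := ℕ) (β := ι)
  have hreal : ∀ i, ((a i).re : ℂ) = a i := by
    intro i
    rw [← Complex.conj_eq_iff_re]
    exact hsymm.conj_eigenvalue_eq_self (Module.End.hasEigenvalue_of_hasEigenvector
      ⟨Module.End.mem_eigenspace_iff.2 (hb i), hb0 i⟩)
  have hsp : (Submodule.span ℂ (Set.range (b ∘ e)))ᗮ = ⊥ := by
    rw [Set.range_comp, e.range_eq_univ, Set.image_univ, ← Submodule.orthogonal_closure,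
      b.dense_span, Submodule.top_orthogonal_eq_bot]
  refine ⟨HilbertBasis.mkOfOrthogonalEqBot (b.orthonormal.comp e e.injective) hsp,
    fun n => (a (e n)).re⁻¹ - 1, fun n => ?_⟩
  rw [HilbertBasis.coe_mkOfOrthogonalEqBot, Function.comp_apply]
  obtain ⟨h, hL⟩ := hTL ((a (e n))⁻¹ • b (e n))
  have hTb : T ((a (e n))⁻¹ • b (e n)) = b (e n) := by
    rw [map_smul, hb, smul_smul, inv_mul_cancel₀ (ha _), one_smul]
  rw [hTb] at h
  refine ⟨h, ?_⟩
  simp only [hTb] at hL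
  push_cast
  rw [hreal, sub_smul, one_smul, ← hL]
  abel

section Eigenbasis

variable {L : H →ₗ.[ℂ] H} {φ : HilbertBasis ℕ ℂ H} {μ : ℕ → ℝ}

theorem IsEigenbasis.pos (hφ : IsEigenbasis L φ μ) (hpos : IsStrictlyPositive L) (n : ℕ) :
    0 < μ n := by
  obtain ⟨h, hL⟩ := hφ n
  have := hpos ⟨φ n, h⟩ (φ.orthonormal.ne_zero n)
  rw [hL, inner_smul_left, inner_self_eq_norm_sq_to_K, φ.orthonormal.1] at this
  simpa using this

/-- The numbers `(μₙ - z)⁻¹` are eigenvalues of the compact resolvent, so only finitely many exceed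
a given modulus. The filter is `cofinite` since the eigenvalues are not ordered. -/
theorem IsEigenbasis.tendsto (hφ : IsEigenbasis L φ μ) (hres : HasCompactResolvent L) :
    Tendsto (fun n => |μ n|) cofinite atTop := by
  obtain ⟨z, R, hR, -, hR2⟩ := hres
  have hz : ∀ n, ((μ n : ℂ) - z) • R (φ n) = φ n := by
    intro n
    obtain ⟨h, hL⟩ := hφ n
    have := hR2 ⟨φ n, h⟩
    rw [hL] at this
    simp only [← sub_smul, map_smul] at this
    exact this
  have hne : ∀ n, (μ n : ℂ) - z ≠ 0 := by
    intro n h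
    have := hz n
    rw [h, zero_smul] at this
    exact φ.orthonormal.ne_zero n this.symm
  have hev : ∀ n, R (φ n) = ((μ n : ℂ) - z)⁻¹ • φ n := by
    intro n
    rw [eq_inv_smul_iff₀ (hne n), hz]
  rw [tendsto_atTop]
  intro B
  have hc : 0 < (|B| + ‖z‖ + 1)⁻¹ := by positivity
  have hfin := φ.orthonormal.finite_setOf_le_norm_eigenvalue hR hev hc
  refine hfin.subset ?_
  intro n hn
  simp only [Set.mem_compl_iff, Set.mem_ofPred_eq, not_le] at hn ⊢
  rw [norm_inv]
  refine inv_anti₀ (norm_pos_iff.2 (hne n)) ?_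
  have h1 := norm_sub_le (μ n : ℂ) z
  rw [Complex.norm_real, Real.norm_eq_abs] at h1
  linarith [le_abs_self B]

/-- `x ∈ D(L)` and `L x = y` if and only if this holds for all coefficients. -/
theorem IsEigenbasis.apply_eq_iff [CompleteSpace H] (hφ : IsEigenbasis L φ μ)
    (hself : IsSelfAdjoint L) (x y : H) :
    (∃ h : x ∈ L.domain, L ⟨x, h⟩ = y) ↔ ∀ n, ⟪φ n, y⟫_ℂ = μ n * ⟪φ n, x⟫_ℂ := by
  have key : ∀ (n : ℕ) (u : L.domain), ⟪φ n, L u⟫_ℂ = μ n * ⟪φ n, (u : H)⟫_ℂ := by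
    intro n u
    obtain ⟨h, hL⟩ := hφ n
    have := inner_apply_left_of_isSelfAdjoint hself ⟨φ n, h⟩ u
    rw [hL, inner_smul_left] at this
    simpa using this.symm
  constructor
  · rintro ⟨h, rfl⟩ n
    exact key n ⟨x, h⟩
  · intro hxy
    -- By Parseval the coefficient relation says that `x` lies in the domain of the adjoint with
    -- value `y`; self-adjointness brings this back to `L`.
    have hw : ∀ u : L.domain, ⟪y, (u : H)⟫_ℂ = ⟪x, L u⟫_ℂ := by
      intro u
      rw [← φ.tsum_inner_mul_inner y u, ← φ.tsum_inner_mul_inner x (L u)]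
      refine tsum_congr fun n => ?_
      rw [key, ← inner_conj_symm y, hxy, ← inner_conj_symm x]
      simp only [map_mul, Complex.conj_ofReal]
      ring
    have hx : x ∈ L.adjoint.domain := L.mem_adjoint_domain_of_exists x ⟨y, hw⟩
    have hL : L.adjoint ⟨x, hx⟩ = y := LinearPMap.adjoint_apply_eq hself.dense_domain ⟨x, hx⟩ hw
    have hE := LinearPMap.isSelfAdjoint_def.1 hself
    have : ∀ A : H →ₗ.[ℂ] H, A = L → ∀ hx : x ∈ A.domain, A ⟨x, hx⟩ = y →
        ∃ h : x ∈ L.domain, L ⟨x, h⟩ = y := by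
      rintro A rfl hx h
      exact ⟨hx, h⟩
    exact this _ hE hx hL

end Eigenbasis

end MGT

namespace MGT

/-! ### The characteristic equation -/

theorem eval_charPoly (α β m : ℝ) (z : ℂ) :
    (charPoly α β m).eval z = α * z ^ 3 + z ^ 2 + β * m * z + m := by
  simp [charPoly]

theorem natDegree_charPoly {α : ℝ} (hα : α ≠ 0) (β m : ℝ) : (charPoly α β m).natDegree = 3 := by
  have : (α : ℂ) ≠ 0 := by exact_mod_cast hα
  unfold charPoly
  compute_degree!

theorem coeff_three_charPoly (α β m : ℝ) : (charPoly α β m).coeff 3 = α := by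
  simp [charPoly, Polynomial.coeff_X_pow]

theorem charPoly_factorization {α : ℝ} (hα : α ≠ 0) (β m : ℝ) (z : ℂ) :
    α * z ^ 3 + z ^ 2 + β * m * z + m =
      α * ((z - charRoot α β m 0) * (z - charRoot α β m 1) * (z - charRoot α β m 2)) := by
  -- The list of roots has length three, so the default value in `charRoot` never occurs.
  have hcard : Multiset.card (charPoly α β m).roots = 3 := by
    rw [← natDegree_charPoly hα β m]
    exact (IsAlgClosed.splits (charPoly α β m)).natDegree_eq_card_roots.symm
  have hfac := Polynomial.C_leadingCoeff_mul_prod_multiset_X_sub_C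
    (hcard.trans (natDegree_charPoly hα β m).symm)
  have hlead : (charPoly α β m).leadingCoeff = α := by
    rw [Polynomial.leadingCoeff, natDegree_charPoly hα, coeff_three_charPoly]
  obtain ⟨a, b, c, habc⟩ := List.length_eq_three.1
    ((Multiset.length_toList _).trans hcard)
  have hroots : (charPoly α β m).roots = ([a, b, c] : List ℂ) := by
    rw [← habc, Multiset.coe_toList]
  have h := congrArg (Polynomial.eval z) hfac
  rw [eval_charPoly, hlead, hroots] at h
  simp only [charRoot, habc]
  rw [← h]
  simp only [Multiset.map_coe, Multiset.prod_coe, List.map_cons, List.map_nil, List.prod_cons,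
    List.prod_nil, mul_one, Polynomial.eval_mul, Polynomial.eval_C, Polynomial.eval_sub,
    Polynomial.eval_X, mul_assoc]
  rfl

theorem charRoot_vieta {α : ℝ} (hα : α ≠ 0) (β m : ℝ) :
    α * (charRoot α β m 0 + charRoot α β m 1 + charRoot α β m 2) = -1 ∧
    α * (charRoot α β m 0 * charRoot α β m 1 + charRoot α β m 0 * charRoot α β m 2
      + charRoot α β m 1 * charRoot α β m 2) = β * m ∧
    α * (charRoot α β m 0 * charRoot α β m 1 * charRoot α β m 2) = -m := by
  have h0 := charPoly_factorization hα β m 0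
  have h1 := charPoly_factorization hα β m 1
  have h2 := charPoly_factorization hα β m (-1)
  refine ⟨?_, ?_, ?_⟩
  · linear_combination (1 / 2 : ℂ) * h1 + (1 / 2 : ℂ) * h2 - h0
  · linear_combination (1 / 2 : ℂ) * h2 - (1 / 2 : ℂ) * h1
  · linear_combination h0

theorem charRoot_isRoot {α : ℝ} (hα : α ≠ 0) (β m : ℝ) (j : Fin 3) :
    α * charRoot α β m j ^ 3 + charRoot α β m j ^ 2 + β * m * charRoot α β m j + m = 0 := by
  rw [charPoly_factorization hα]
  fin_cases j <;> simp

/-- The Vandermonde determinant of the three characteristic roots. -/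
noncomputable def vandermonde (α β m : ℝ) : ℂ :=
  (charRoot α β m 1 - charRoot α β m 0) * (charRoot α β m 2 - charRoot α β m 0)
    * (charRoot α β m 2 - charRoot α β m 1)

/-- This is the discriminant of the cubic: a symmetric function of the roots, rewritten by Vieta's
formulas. -/
theorem vandermonde_sq {α : ℝ} (hα : α ≠ 0) (β m : ℝ) :
    (α : ℂ) ^ 4 * vandermonde α β m ^ 2 =
      -m * (4 * α * β ^ 3 * m ^ 2 + (27 * α ^ 2 - 18 * α * β - β ^ 2) * m + 4) := by
  obtain ⟨h1, h2, h3⟩ := charRoot_vieta hα β m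
  unfold vandermonde
  set a := charRoot α β m 0
  set b := charRoot α β m 1
  set c := charRoot α β m 2
  have : (α : ℂ) ^ 4 * ((b - a) * (c - a) * (c - b)) ^ 2 =
      (α * (a + b + c)) ^ 2 * (α * (a * b + a * c + b * c)) ^ 2
      - 4 * α * (α * (a * b + a * c + b * c)) ^ 3
      - 4 * (α * (a + b + c)) ^ 3 * (α * (a * b * c))
      + 18 * α * (α * (a + b + c)) * (α * (a * b + a * c + b * c)) * (α * (a * b * c))
      - 27 * α ^ 2 * (α * (a * b * c)) ^ 2 := by ring
  rw [this, h1, h2, h3]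
  ring

theorem sq_complexSqrt (z : ℂ) : Complex.sqrt z ^ 2 = z := by
  rw [Complex.sqrt, ← Complex.cpow_nat_mul]
  simp

/-- Comparison of sum and product: `m₁ m₂ = 1 / (α β³)` because `C₁² - C₂ = 64 (β/α)³`. The complex
square root covers `C₂ < 0` as well. -/
theorem discriminant_eq {α β : ℝ} (hα : α ≠ 0) (hβ : β ≠ 0) (m : ℝ) :
    4 * α * (β : ℂ) ^ 3 * m ^ 2 + (27 * α ^ 2 - 18 * α * β - β ^ 2) * m + 4 =
      4 * α * β ^ 3 * ((m - m₁ α β) * (m - m₂ α β)) := by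
  have hα' : (α : ℂ) ≠ 0 := by exact_mod_cast hα
  have hβ' : (β : ℂ) ≠ 0 := by exact_mod_cast hβ
  have hs := sq_complexSqrt (C₂ α β : ℂ)
  have hsum : m₁ α β + m₂ α β = -(α * (C₁ α β : ℂ)) / (4 * β ^ 3) := by
    unfold m₁ m₂
    field_simp
    ring
  have hprod : m₁ α β * m₂ α β = 1 / (α * β ^ 3) := by
    have : m₁ α β * m₂ α β
        = α ^ 2 * ((C₁ α β : ℂ) ^ 2 - Complex.sqrt (C₂ α β : ℂ) ^ 2) / (64 * β ^ 6) := by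
      unfold m₁ m₂
      field_simp
      ring
    rw [this, hs, C₂]
    push_cast
    field_simp
    ring
  have h : ((m : ℂ) - m₁ α β) * (m - m₂ α β)
      = m ^ 2 - (m₁ α β + m₂ α β) * m + m₁ α β * m₂ α β := by ring
  rw [h, hsum, hprod, C₁]
  push_cast
  field_simp
  ring

theorem vandermonde_eq_zero_iff {α β m : ℝ} (hα : 0 < α) (hβ : 0 < β) (hm : 0 < m) :
    vandermonde α β m = 0 ↔ (m : ℂ) = m₁ α β ∨ (m : ℂ) = m₂ α β := by
  have h := vandermonde_sq hα.ne' β m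
  rw [discriminant_eq hα.ne' hβ.ne'] at h
  have hα' : (α : ℂ) ≠ 0 := by exact_mod_cast hα.ne'
  have hβ' : (β : ℂ) ≠ 0 := by exact_mod_cast hβ.ne'
  have hm' : (m : ℂ) ≠ 0 := by exact_mod_cast hm.ne'
  rw [← sub_eq_zero (b := m₁ α β), ← sub_eq_zero (b := m₂ α β), ← mul_eq_zero]
  constructor
  · intro h0
    rw [h0] at h
    by_contra hne
    have : -(m : ℂ) * (4 * α * β ^ 3 * ((m - m₁ α β) * (m - m₂ α β))) ≠ 0 := by
      refine mul_ne_zero (neg_ne_zero.2 hm') (mul_ne_zero ?_ hne)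
      simp [hα', hβ']
    exact this (by rw [← h]; ring)
  · intro h0
    rw [h0] at h
    have h1 : (α : ℂ) ^ 4 * vandermonde α β m ^ 2 = 0 := by rw [h]; ring
    simpa [hα'] using h1

/-! ### Location of the roots -/

/-- The cubic is `x² (α x + 1) + m (β x + 1)`. If `x ≥ -1/β`, then `α < β` gives `α x + 1 > 0`, so
both summands are nonnegative and must vanish, which is impossible. -/
theorem real_root_lt {α β m x : ℝ} (hα : 0 < α) (hαβ : α < β) (hm : 0 < m)
    (hx : α * x ^ 3 + x ^ 2 + β * m * x + m = 0) : x < -(1 / β) := by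
  have hβ : 0 < β := hα.trans hαβ
  suffices β * x + 1 < 0 by
    rw [← neg_div, lt_div_iff₀ hβ]
    linarith
  by_contra! h
  have h1 : 0 < α * x + 1 := by
    by_contra! h1
    nlinarith
  have h2 : x ^ 2 * (α * x + 1) + m * (β * x + 1) = 0 := by linarith
  have h3 : 0 ≤ x ^ 2 * (α * x + 1) := by positivity
  have h4 : 0 ≤ m * (β * x + 1) := by positivity
  have h5 : x ^ 2 * (α * x + 1) = 0 := by linarith
  have h6 : m * (β * x + 1) = 0 := by linarith
  have h7 : x = 0 := by simpa [h1.ne'] using h5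
  rw [h7] at h6
  simp at h6
  exact hm.ne' h6

/-- With `s = α x + 1`, which lies in `(0, 1)`, the equation reads `(α x)² s = m α (β - α - β s)`.
As `(α x)² ≤ 1`, this bounds `s` below, uniformly for `m ≥ m₀`. -/
theorem real_root_ge {α β m₀ m x : ℝ} (hα : 0 < α) (hαβ : α < β) (hm₀ : 0 < m₀) (hm : m₀ ≤ m)
    (hx : α * x ^ 3 + x ^ 2 + β * m * x + m = 0) :
    m₀ * α * (β - α) / (1 + α * β * m₀) ≤ α * x + 1 := by
  have hβ : 0 < β := hα.trans hαβ
  have hmp : 0 < m := hm₀.trans_le hm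
  have h2 : x ^ 2 * (α * x + 1) + m * (β * x + 1) = 0 := by linarith
  have hneg : x < 0 := (real_root_lt hα hαβ hmp hx).trans (by simpa using hβ)
  have hs : 0 < α * x + 1 := by
    by_contra! h
    have h3 : β * x + 1 < 0 := by nlinarith
    have h4 : m * (β * x + 1) < 0 := mul_neg_of_pos_of_neg hmp h3
    have h5 : x ^ 2 * (α * x + 1) ≤ 0 := mul_nonpos_of_nonneg_of_nonpos (sq_nonneg x) h
    linarith
  have hαx : α * x < 0 := mul_neg_of_pos_of_neg hα hneg
  have hx2 : (α * x) ^ 2 ≤ 1 := by nlinarith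
  rw [div_le_iff₀ (by positivity)]
  have h3 : (α * x) ^ 2 * (α * x + 1) ≤ 1 * (α * x + 1) := by gcongr
  have h4 : (α * x) ^ 2 * (α * x + 1) = m * α * (β - α) - α * β * m * (α * x + 1) := by
    linear_combination α ^ 2 * h2
  have h5 : m * (α * (β - α) - α * β * (α * x + 1)) ≤ α * x + 1 := by nlinarith
  rcases le_or_gt 0 (α * (β - α) - α * β * (α * x + 1)) with h6 | h6
  · have : m₀ * (α * (β - α) - α * β * (α * x + 1)) ≤ m * (α * (β - α) - α * β * (α * x + 1)) := by
      gcongr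
    nlinarith
  · have : m₀ * (α * (β - α) - α * β * (α * x + 1)) < 0 := mul_neg_of_pos_of_neg hm₀ h6
    nlinarith

theorem root_re_le {α β m₀ m : ℝ} {z : ℂ} (hα : 0 < α) (hαβ : α < β) (hm₀ : 0 < m₀) (hm : m₀ ≤ m)
    (hz : (α : ℂ) * z ^ 3 + z ^ 2 + β * m * z + m = 0) :
    z.re ≤ max (-(1 / β)) (-(m₀ * α * (β - α) / (1 + α * β * m₀) / (2 * α))) := by
  have hre := congrArg Complex.re hz
  have him := congrArg Complex.im hz
  simp only [pow_succ, pow_zero, one_mul, Complex.add_re, Complex.add_im, Complex.mul_re,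
    Complex.mul_im, Complex.ofReal_re, Complex.ofReal_im, Complex.zero_re,
    Complex.zero_im] at hre him
  ring_nf at hre him
  set x := z.re
  set y := z.im
  by_cases hy : y = 0
  · rw [hy] at hre
    refine le_max_of_le_left (real_root_lt hα hαβ (hm₀.trans_le hm) (x := x) ?_).le
    linear_combination hre
  · refine le_max_of_le_right ?_
    have h1 : α * (3 * x ^ 2 - y ^ 2) + 2 * x + β * m = 0 := by
      apply mul_left_cancel₀ hy
      linear_combination him
    -- `r` is the third root, which is real because the sum of the roots is `-1/α`. Then `α r + 1 =
    -- -2 α x` turns the lower bound for `α r + 1` into an upper bound for `x`.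
    obtain ⟨r, hr⟩ : ∃ r, α * r + 1 = -(2 * α * x) := ⟨-(1 / α) - 2 * x, by field_simp; ring⟩
    have h2 : α * r ^ 3 + r ^ 2 + β * m * r + m = 0 := by
      linear_combination (r ^ 2 - 2 * x * r + x ^ 2 + y ^ 2) * hr + hre + (r - x) * h1
    have h3 := real_root_ge hα hαβ hm₀ hm h2
    rw [hr] at h3
    rw [le_neg, div_le_iff₀ (by positivity)]
    linarith

section Sigma

variable {μ : ℕ → ℝ} {α β : ℝ}

theorem charRoot_re_mem (hα : 0 < α) (n : ℕ) (j : Fin 3) :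
    (charRoot α β (μ n) j).re ∈ realParts μ α β :=
  ⟨n, _, charRoot_isRoot hα.ne' β (μ n) j, rfl⟩

theorem exists_forall_realParts_le (hα : 0 < α) (hαβ : α < β) {m₀ : ℝ} (hm₀ : 0 < m₀)
    (hμ : ∀ n, m₀ ≤ μ n) : ∃ s < 0, ∀ x ∈ realParts μ α β, x ≤ s := by
  have hβ : 0 < β := hα.trans hαβ
  refine ⟨max (-(1 / β)) (-(m₀ * α * (β - α) / (1 + α * β * m₀) / (2 * α))), ?_, ?_⟩
  · have : 0 < β - α := sub_pos.2 hαβ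
    rw [max_lt_iff, neg_lt_zero, neg_lt_zero]
    constructor <;> positivity
  · rintro x ⟨n, z, hz, rfl⟩
    exact root_re_le hα hαβ hm₀ (hμ n) hz

theorem sigmaMax_isLUB (hα : 0 < α) (hαβ : α < β) {m₀ : ℝ} (hm₀ : 0 < m₀)
    (hμ : ∀ n, m₀ ≤ μ n) : IsLUB (realParts μ α β) (sigmaMax μ α β) := by
  obtain ⟨s, -, hs⟩ := exists_forall_realParts_le hα hαβ hm₀ hμ
  exact isLUB_csSup ⟨_, charRoot_re_mem hα 0 0⟩ ⟨s, hs⟩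

theorem sigmaMax_neg (hα : 0 < α) (hαβ : α < β) {m₀ : ℝ} (hm₀ : 0 < m₀)
    (hμ : ∀ n, m₀ ≤ μ n) : sigmaMax μ α β < 0 := by
  obtain ⟨s, hs0, hs⟩ := exists_forall_realParts_le hα hαβ hm₀ hμ
  exact ((sigmaMax_isLUB hα hαβ hm₀ hμ).2 hs).trans_lt hs0

/-- There are real roots arbitrarily close to `-1/β`: the cubic has the value `(β - α)/β³ > 0` at
`-1/β` for every `m`, while at `-1/β - ε` the term `-m β ε` makes it nonpositive for large `m`. -/
theorem neg_inv_le_sigmaMax (hα : 0 < α) (hαβ : α < β)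
    (hLUB : IsLUB (realParts μ α β) (sigmaMax μ α β))
    (hμ : Tendsto μ cofinite atTop) : -(1 / β) ≤ sigmaMax μ α β := by
  have hβ : 0 < β := hα.trans hαβ
  refine le_of_forall_pos_sub_le fun ε hε => ?_
  let p : ℝ → ℝ → ℝ := fun m x => α * x ^ 3 + x ^ 2 + β * m * x + m
  set a := -(1 / β) - ε
  obtain ⟨n, hn⟩ := (hμ.eventually_gt_atTop ((α * a ^ 3 + a ^ 2) / (β * ε))).exists
  have hcont : ContinuousOn (p (μ n)) (Set.Icc a (-(1 / β))) := by
    apply Continuous.continuousOn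
    fun_prop
  have ha : p (μ n) a ≤ 0 := by
    rw [div_lt_iff₀ (by positivity)] at hn
    have : p (μ n) a = α * a ^ 3 + a ^ 2 - μ n * (β * ε) := by
      simp only [p, a]
      field_simp
      ring
    linarith
  have hb : 0 ≤ p (μ n) (-(1 / β)) := by
    have : p (μ n) (-(1 / β)) = (β - α) / β ^ 3 := by
      simp only [p]
      field_simp
      ring
    rw [this]
    have : 0 < β - α := sub_pos.2 hαβ
    positivity
  obtain ⟨x, hx, hpx⟩ := intermediate_value_Icc (by simp only [a]; linarith) hcont ⟨ha, hb⟩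
  refine hx.1.trans (hLUB.1 ⟨n, (x : ℂ), ?_, by simp⟩)
  simp only [p] at hpx
  exact_mod_cast hpx

/-- If the three roots are not distinct, then they all lie to the left of `-1/β`. -/
theorem charRoot_re_lt_of_vandermonde_eq_zero {m : ℝ} (hα : 0 < α) (hαβ : α < β) (hm : 0 < m)
    (hV : vandermonde α β m = 0) (j : Fin 3) : (charRoot α β m j).re < -(1 / β) := by
  suffices h : ∀ k, (charRoot α β m k).im = 0 by
    have hr := congrArg Complex.re (charRoot_isRoot hα.ne' β m j)
    have hj : charRoot α β m j = ((charRoot α β m j).re : ℂ) :=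
      Complex.ext (by simp) (by simp [h j])
    rw [hj] at hr
    refine real_root_lt hα hαβ hm ?_
    exact_mod_cast hr
  -- For a double root `a` and third root `b`, the sum gives `b.im = -2 a.im`, and the other two
  -- relations then force `a.im ^ 3 = 0`. So all roots are real.
  have key : ∀ a b : ℂ, (α : ℂ) * (a + a + b) = -1 →
      (α : ℂ) * (a * a + a * b + a * b) = β * m → (α : ℂ) * (a * a * b) = -m →
      a.im = 0 ∧ b.im = 0 := by
    intro a b h1 h2 h3
    have i1 := congrArg Complex.im h1
    have i3 := congrArg Complex.im h3
    have i2 := congrArg Complex.im h2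
    simp [hα.ne'] at i1 i2 i3
    have hb : b.im = -2 * a.im := by linarith
    have : a.im ^ 3 = 0 := by
      rw [hb] at i2 i3
      linear_combination (1 / 2) * i3 - (1 / 2) * a.re * i2
    have ha : a.im = 0 := by simpa using this
    exact ⟨ha, by rw [hb, ha]; simp⟩
  obtain ⟨h1, h2, h3⟩ := charRoot_vieta hα.ne' β m
  unfold vandermonde at hV
  rw [mul_eq_zero, mul_eq_zero, sub_eq_zero, sub_eq_zero, sub_eq_zero] at hV
  rcases hV with (h | h) | h
  · rw [h] at h1 h2 h3
    obtain ⟨ha, hb⟩ := key _ _ h1 h2 h3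
    intro k; fin_cases k <;> simp [h, ha, hb]
  · rw [h] at h1 h2 h3
    obtain ⟨ha, hb⟩ := key (charRoot α β m 0) (charRoot α β m 1) (by rw [← h1]; ring)
      (by rw [← h2]; ring) (by rw [← h3]; ring)
    intro k; fin_cases k <;> simp [h, ha, hb]
  · rw [h] at h1 h2 h3
    obtain ⟨ha, hb⟩ := key (charRoot α β m 1) (charRoot α β m 0) (by rw [← h1]; ring)
      (by rw [← h2]; ring) (by rw [← h3]; ring)
    intro k; fin_cases k <;> simp [h, ha, hb]

end Sigma

end MGT

namespace MGT

/-! ### Square norms on `ℂ³` -/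

/-- The square of the Euclidean norm on `ℂ³`. -/
noncomputable def normSq₃ (x : Fin 3 → ℂ) : ℝ := ∑ r, ‖x r‖ ^ 2

theorem normSq₃_nonneg (x : Fin 3 → ℂ) : 0 ≤ normSq₃ x := by
  unfold normSq₃
  positivity

theorem normSq₃_eq_zero {x : Fin 3 → ℂ} : normSq₃ x = 0 ↔ x = 0 := by
  unfold normSq₃
  rw [Finset.sum_eq_zero_iff_of_nonneg (fun _ _ => by positivity)]
  simp [funext_iff]

theorem star_dotProduct_self (x : Fin 3 → ℂ) : star x ⬝ᵥ x = (normSq₃ x : ℂ) := by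
  simp only [dotProduct, normSq₃, Pi.star_apply, Complex.ofReal_sum]
  refine Finset.sum_congr rfl fun r _ => ?_
  rw [RCLike.star_def, Complex.conj_mul']
  norm_cast

theorem normSq₃_smul (c : ℂ) (x : Fin 3 → ℂ) : normSq₃ (c • x) = ‖c‖ ^ 2 * normSq₃ x := by
  simp [normSq₃, Finset.mul_sum, mul_pow]

theorem norm_sum_three_sq_le (a : Fin 3 → ℂ) : ‖∑ j, a j‖ ^ 2 ≤ 3 * ∑ j, ‖a j‖ ^ 2 := by
  have h1 : ‖∑ j, a j‖ ^ 2 ≤ (∑ j, ‖a j‖) ^ 2 := by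
    gcongr
    exact norm_sum_le _ _
  refine h1.trans ?_
  simpa using sq_sum_le_card_mul_sum_sq (s := (Finset.univ : Finset (Fin 3))) (f := fun j => ‖a j‖)

theorem normSq₃_mulVec_le {A : Matrix (Fin 3) (Fin 3) ℂ} {b : ℝ} (hA : ∀ r j, ‖A r j‖ ≤ b)
    (x : Fin 3 → ℂ) : normSq₃ (A *ᵥ x) ≤ 9 * b ^ 2 * normSq₃ x := by
  have hrow : ∀ r, ‖(A *ᵥ x) r‖ ^ 2 ≤ 3 * (b ^ 2 * normSq₃ x) := by
    intro r
    refine (norm_sum_three_sq_le fun j => A r j * x j).trans ?_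
    rw [normSq₃, Finset.mul_sum _ _ (b ^ 2)]
    refine mul_le_mul_of_nonneg_left (Finset.sum_le_sum fun j _ => ?_) (by norm_num)
    rw [norm_mul, mul_pow]
    gcongr
    exact hA r j
  calc normSq₃ (A *ᵥ x) ≤ ∑ _r : Fin 3, 3 * (b ^ 2 * normSq₃ x) := by
        unfold normSq₃ at hrow ⊢
        exact Finset.sum_le_sum fun r _ => hrow r
    _ = 9 * b ^ 2 * normSq₃ x := by
        simp
        ring

theorem exists_normSq₃_mulVec_le (A : Matrix (Fin 3) (Fin 3) ℂ) :
    ∃ K > 0, ∀ x, normSq₃ (A *ᵥ x) ≤ K * normSq₃ x := by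
  have hb : ∀ r j, ‖A r j‖ ≤ 1 + ∑ r, ∑ j, ‖A r j‖ := by
    intro r j
    have h1 : ‖A r j‖ ≤ ∑ j, ‖A r j‖ :=
      Finset.single_le_sum (f := fun j => ‖A r j‖) (fun _ _ => norm_nonneg _) (Finset.mem_univ j)
    have h2 : ∑ j, ‖A r j‖ ≤ ∑ r, ∑ j, ‖A r j‖ :=
      Finset.single_le_sum (f := fun r => ∑ j, ‖A r j‖)
        (fun _ _ => Finset.sum_nonneg fun _ _ => norm_nonneg _) (Finset.mem_univ r)
    linarith
  have hpos : 0 < 1 + ∑ r, ∑ j, ‖A r j‖ := by positivity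
  exact ⟨9 * (1 + ∑ r, ∑ j, ‖A r j‖) ^ 2, by positivity, normSq₃_mulVec_le hb⟩

/-- Apply the adjugate to `A y`: its entries are `2 × 2` minors, of modulus at most `2`, and `9 · 2²
= 36`. -/
theorem norm_det_sq_mul_normSq₃_le {A : Matrix (Fin 3) (Fin 3) ℂ} (hA : ∀ r j, ‖A r j‖ ≤ 1)
    (y : Fin 3 → ℂ) : ‖A.det‖ ^ 2 * normSq₃ y ≤ 36 * normSq₃ (A *ᵥ y) := by
  have hadj : ∀ r j, ‖A.adjugate r j‖ ≤ 2 := by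
    have key : ∀ p q s t : ℂ, ‖p‖ ≤ 1 → ‖q‖ ≤ 1 → ‖s‖ ≤ 1 → ‖t‖ ≤ 1 →
        ‖p * q - s * t‖ ≤ 2 ∧ ‖-(p * q) + s * t‖ ≤ 2 := by
      intro p q s t hp hq hs ht
      have h1 : ‖p * q‖ ≤ 1 := by
        rw [norm_mul]
        exact mul_le_one₀ hp (norm_nonneg _) hq
      have h2 : ‖s * t‖ ≤ 1 := by
        rw [norm_mul]
        exact mul_le_one₀ hs (norm_nonneg _) ht
      constructor
      · linarith [norm_sub_le (p * q) (s * t)]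
      · have := norm_add_le (-(p * q)) (s * t)
        rw [norm_neg] at this
        linarith
    rw [Matrix.adjugate_fin_three]
    intro r j
    fin_cases r <;> fin_cases j <;>
      simp only [Matrix.of_apply, Matrix.cons_val, Fin.zero_eta, Fin.mk_one, Fin.reduceFinMk] <;>
      first
        | exact (key _ _ _ _ (hA _ _) (hA _ _) (hA _ _) (hA _ _)).1
        | exact (key _ _ _ _ (hA _ _) (hA _ _) (hA _ _) (hA _ _)).2
  have h := normSq₃_mulVec_le hadj (A *ᵥ y)
  rw [Matrix.mulVec_mulVec, Matrix.adjugate_mul, Matrix.smul_mulVec, Matrix.one_mulVec,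
    normSq₃_smul] at h
  linarith

/-- The square of the weighted norm `∑ wᵣ ‖xᵣ‖²` on `ℂ³`. -/
noncomputable def weightedSq (w : Fin 3 → ℝ) (x : Fin 3 → ℂ) : ℝ := ∑ r, w r * ‖x r‖ ^ 2

/-- The diagonal matrix with the entries `√wᵣ`. -/
noncomputable def sqrtDiag (w : Fin 3 → ℝ) : Matrix (Fin 3) (Fin 3) ℂ :=
  Matrix.diagonal fun r => ((√(w r) : ℝ) : ℂ)

theorem weightedSq_eq {w : Fin 3 → ℝ} (hw : ∀ r, 0 ≤ w r) (x : Fin 3 → ℂ) :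
    weightedSq w x = normSq₃ (sqrtDiag w *ᵥ x) := by
  unfold weightedSq normSq₃ sqrtDiag
  refine Finset.sum_congr rfl fun r _ => ?_
  rw [Matrix.mulVec_diagonal, norm_mul, mul_pow, Complex.norm_real, Real.norm_eq_abs, sq_abs,
    Real.sq_sqrt (hw r)]

theorem det_sqrtDiag_ne_zero {w : Fin 3 → ℝ} (hw : ∀ r, 0 < w r) : (sqrtDiag w).det ≠ 0 := by
  rw [sqrtDiag, Matrix.det_diagonal, Finset.prod_ne_zero_iff]
  intro r _
  exact_mod_cast (Real.sqrt_pos.2 (hw r)).ne'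

/-- The norm defined by an invertible matrix is equivalent to the weighted norm. -/
theorem exists_weightedSq_equiv {w : Fin 3 → ℝ} (hw : ∀ r, 0 < w r)
    {S : Matrix (Fin 3) (Fin 3) ℂ} (hS : IsUnit S.det) :
    ∃ c C, 0 < c ∧ 0 < C ∧ ∀ x, c * weightedSq w x ≤ normSq₃ (S *ᵥ x) ∧
      normSq₃ (S *ᵥ x) ≤ C * weightedSq w x := by
  have hD : IsUnit (sqrtDiag w).det := (det_sqrtDiag_ne_zero hw).isUnit
  obtain ⟨K, hK, h1⟩ := exists_normSq₃_mulVec_le (sqrtDiag w * S⁻¹)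
  obtain ⟨C, hC, h2⟩ := exists_normSq₃_mulVec_le (S * (sqrtDiag w)⁻¹)
  refine ⟨K⁻¹, C, inv_pos.2 hK, hC, fun x => ⟨?_, ?_⟩⟩
  · have := h1 (S *ᵥ x)
    rw [Matrix.mulVec_mulVec, Matrix.mul_assoc, Matrix.nonsing_inv_mul _ hS, Matrix.mul_one,
      ← weightedSq_eq fun r => (hw r).le] at this
    rwa [inv_mul_le_iff₀ hK]
  · have := h2 (sqrtDiag w *ᵥ x)
    rwa [Matrix.mulVec_mulVec, Matrix.mul_assoc, Matrix.nonsing_inv_mul _ hD, Matrix.mul_one,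
      ← weightedSq_eq fun r => (hw r).le] at this

/-! ### The blocks of the generator -/

/-- The matrix of the restriction of `A` to `Eₙ`, with `m = μₙ`. -/
noncomputable def genMatrix (α β m : ℝ) : Matrix (Fin 3) (Fin 3) ℂ :=
  !![0, 1, 0; 0, 0, 1; -(m / α), -(β * m / α), -(1 / α)]

theorem genMatrix_mulVec_eigenvector {α β m : ℝ} (hα : α ≠ 0) {z : ℂ}
    (hz : (α : ℂ) * z ^ 3 + z ^ 2 + β * m * z + m = 0) :
    genMatrix α β m *ᵥ (fun r => z ^ (r : ℕ)) = z • fun r : Fin 3 => z ^ (r : ℕ) := by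
  have hα' : (α : ℂ) ≠ 0 := by exact_mod_cast hα
  ext r
  fin_cases r
  · simp [genMatrix, Matrix.mulVec, dotProduct, Fin.sum_univ_three]
  · simp [genMatrix, Matrix.mulVec, dotProduct, Fin.sum_univ_three]
    ring
  · simp [genMatrix, Matrix.mulVec, dotProduct, Fin.sum_univ_three]
    field_simp
    linear_combination -hz

/-- If the characteristic roots are not distinct, then the block has a Jordan chain. -/
theorem exists_jordan_chain {α β m : ℝ} (hα : α ≠ 0) (hV : vandermonde α β m = 0) :
    ∃ (a : ℂ) (p q : Fin 3 → ℂ), p ≠ 0 ∧ genMatrix α β m *ᵥ p = a • p ∧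
      genMatrix α β m *ᵥ q = a • q + p := by
  have hα' : (α : ℂ) ≠ 0 := by exact_mod_cast hα
  -- The vector `(0, 1, 2a)` is the derivative of `(1, λ, λ²)` at `λ = a`. Differentiating the
  -- eigenvector equation, whose defect is proportional to the cubic, gives the chain at a double
  -- root.
  have key : ∀ a b : ℂ, (α : ℂ) * (a + a + b) = -1 →
      (α : ℂ) * (a * a + a * b + a * b) = β * m → (α : ℂ) * (a * a * b) = -m →
      genMatrix α β m *ᵥ ![0, 1, 2 * a] = a • ![0, 1, 2 * a] + fun r : Fin 3 => a ^ (r : ℕ) := by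
    intro a b h1 h2 h3
    ext r
    fin_cases r
    · simp [genMatrix, Matrix.mulVec, dotProduct, Fin.sum_univ_three]
    · simp [genMatrix, Matrix.mulVec, dotProduct, Fin.sum_univ_three]
      ring
    · simp [genMatrix, Matrix.mulVec, dotProduct, Fin.sum_univ_three]
      field_simp
      linear_combination -2 * a * h1 + h2
  have hne : ∀ a : ℂ, (fun r : Fin 3 => a ^ (r : ℕ)) ≠ 0 := by
    intro a h
    simpa using congrFun h 0
  have main : ∃ (j : Fin 3) (b : ℂ), (α : ℂ) * (charRoot α β m j + charRoot α β m j + b) = -1 ∧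
      (α : ℂ) * (charRoot α β m j * charRoot α β m j + charRoot α β m j * b
        + charRoot α β m j * b) = β * m ∧
      (α : ℂ) * (charRoot α β m j * charRoot α β m j * b) = -m := by
    obtain ⟨h1, h2, h3⟩ := charRoot_vieta hα β m
    unfold vandermonde at hV
    rw [mul_eq_zero, mul_eq_zero, sub_eq_zero, sub_eq_zero, sub_eq_zero] at hV
    rcases hV with (h | h) | h
    · rw [h] at h1 h2 h3
      exact ⟨0, charRoot α β m 2, h1, h2, h3⟩
    · rw [h] at h1 h2 h3
      exact ⟨0, charRoot α β m 1, by rw [← h1]; ring, by rw [← h2]; ring, by rw [← h3]; ring⟩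
    · rw [h] at h1 h2 h3
      exact ⟨1, charRoot α β m 0, by rw [← h1]; ring, by rw [← h2]; ring, by rw [← h3]; ring⟩
  obtain ⟨j, b, h1, h2, h3⟩ := main
  exact ⟨charRoot α β m j, _, _, hne _,
    genMatrix_mulVec_eigenvector hα (charRoot_isRoot hα β m j), key _ b h1 h2 h3⟩

/-- If all characteristic roots have real part less than `σ`, then the block is, in a suitable
basis, dissipative up to the shift by `σ`. -/
theorem exists_dissipative_basis {α β m σ : ℝ} (hα : α ≠ 0)
    (hσ : ∀ j, (charRoot α β m j).re < σ) :
    ∃ S B : Matrix (Fin 3) (Fin 3) ℂ, IsUnit S.det ∧ S * genMatrix α β m = B * S ∧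
      ∀ y, (star y ⬝ᵥ (B *ᵥ y)).re ≤ σ * normSq₃ y := by
  have hα' : (α : ℂ) ≠ 0 := by exact_mod_cast hα
  obtain ⟨h1, h2, h3⟩ := charRoot_vieta hα β m
  have h0 := hσ 0
  have h0' := hσ 1
  have h0'' := hσ 2
  set a := charRoot α β m 0
  set b := charRoot α β m 1
  set c := charRoot α β m 2
  obtain ⟨ε, hε, hεa, hεb, hεc⟩ : ∃ ε > 0, a.re + ε ≤ σ ∧ b.re + ε ≤ σ ∧ c.re + ε ≤ σ := by
    refine ⟨min (σ - a.re) (min (σ - b.re) (σ - c.re)), ?_, ?_, ?_, ?_⟩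
    · simp [h0, h0', h0'']
    · linarith [min_le_left (σ - a.re) (min (σ - b.re) (σ - c.re))]
    · linarith [min_le_right (σ - a.re) (min (σ - b.re) (σ - c.re)),
        min_le_left (σ - b.re) (σ - c.re)]
    · linarith [min_le_right (σ - a.re) (min (σ - b.re) (σ - c.re)),
        min_le_right (σ - b.re) (σ - c.re)]
  -- The columns are the divided differences of `(1, λ, λ²)` at `a`; `a, b`; `a, b, c`, scaled by
  -- `1, ε, ε²`. They stay independent when roots coincide, and the scaling puts `ε` above the
  -- diagonal of `B`.
  let T : Matrix (Fin 3) (Fin 3) ℂ :=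
    !![1, 0, 0; a, ε, 0; a ^ 2, ε * (a + b), ε ^ 2]
  let B : Matrix (Fin 3) (Fin 3) ℂ := !![a, ε, 0; 0, b, ε; 0, 0, c]
  have hdet : IsUnit T.det := by
    rw [Matrix.det_fin_three]
    simp [T, hε.ne']
  have hMT : genMatrix α β m * T = T * B := by
    ext r j
    fin_cases r <;> fin_cases j <;>
      simp [genMatrix, T, B, Matrix.mul_apply, Fin.sum_univ_three] <;> field_simp
    · linear_combination -a ^ 2 * h1 + a * h2 - h3
    · linear_combination ε * (-(a + b) * h1 + h2)
    · linear_combination -ε ^ 2 * h1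
  refine ⟨T⁻¹, B, Matrix.isUnit_nonsing_inv_det T hdet, ?_, ?_⟩
  · have := congrArg (fun X => T⁻¹ * X * T⁻¹) hMT
    rw [← Matrix.mul_assoc T⁻¹ T, Matrix.nonsing_inv_mul _ hdet, Matrix.one_mul,
      ← Matrix.mul_assoc, Matrix.mul_assoc, Matrix.mul_nonsing_inv _ hdet, Matrix.mul_one] at this
    exact this
  · intro y
    have e : (star y ⬝ᵥ (B *ᵥ y)).re = a.re * ‖y 0‖ ^ 2 + b.re * ‖y 1‖ ^ 2 + c.re * ‖y 2‖ ^ 2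
        + ε * (((y 0).re * (y 1).re + (y 0).im * (y 1).im)
          + ((y 1).re * (y 2).re + (y 1).im * (y 2).im)) := by
      simp only [Complex.sq_norm, Complex.normSq_apply]
      simp [B, Matrix.mulVec, dotProduct, Fin.sum_univ_three]
      ring
    rw [e, normSq₃, Fin.sum_univ_three]
    have hx : ∀ u v : ℂ, u.re * v.re + u.im * v.im ≤ (‖u‖ ^ 2 + ‖v‖ ^ 2) / 2 := by
      intro u v
      simp only [Complex.sq_norm, Complex.normSq_apply]
      nlinarith [sq_nonneg (u.re - v.re), sq_nonneg (u.im - v.im)]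
    -- The off-diagonal entries cost at most `ε ‖y‖²`, which is the gap reserved between the real
    -- parts and `σ`.
    have hcross : ε * (((y 0).re * (y 1).re + (y 0).im * (y 1).im)
          + ((y 1).re * (y 2).re + (y 1).im * (y 2).im))
        ≤ ε * (‖y 0‖ ^ 2 + ‖y 1‖ ^ 2 + ‖y 2‖ ^ 2) := by
      refine mul_le_mul_of_nonneg_left ?_ hε.le
      have := hx (y 0) (y 1)
      have := hx (y 1) (y 2)
      have := sq_nonneg ‖y 0‖
      have := sq_nonneg ‖y 2‖
      linarith
    have ha := mul_le_mul_of_nonneg_right hεa (sq_nonneg ‖y 0‖)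
    have hb := mul_le_mul_of_nonneg_right hεb (sq_nonneg ‖y 1‖)
    have hc := mul_le_mul_of_nonneg_right hεc (sq_nonneg ‖y 2‖)
    linarith

/-! ### The matrices of eigenvectors -/

/-- The weights `mᵏ` of the natural norm on `Eₙ`, with `m = μₙ`. -/
def weight (i : Fin 4) (m : ℝ) (r : Fin 3) : ℝ := m ^ halfExp i r

theorem weight_pos {m : ℝ} (hm : 0 < m) (i : Fin 4) (r : Fin 3) : 0 < weight i m r :=
  pow_pos hm _

theorem eigNorm_sq {m : ℝ} (hm : 0 < m) (i : Fin 4) (l : ℂ) :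
    eigNorm i m l ^ 2 = weightedSq (weight i m) fun r => l ^ (r : ℕ) := by
  rw [eigNorm, Real.sq_sqrt (Finset.sum_nonneg fun r _ => by positivity)]
  rfl

theorem eigNorm_pos {m : ℝ} (hm : 0 < m) (i : Fin 4) (l : ℂ) : 0 < eigNorm i m l := by
  rw [eigNorm, Real.sqrt_pos, Fin.sum_univ_three]
  have : 0 < m ^ halfExp i 0 * ‖l ^ ((0 : Fin 3) : ℕ)‖ ^ 2 := by
    simp
    positivity
  positivity

theorem det_eigMatrix (α β : ℝ) (i : Fin 4) (m : ℝ) :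
    (eigMatrix α β i m).det = vandermonde α β m / (eigNorm i m (charRoot α β m 0)
      * eigNorm i m (charRoot α β m 1) * eigNorm i m (charRoot α β m 2)) := by
  rw [Matrix.det_fin_three, vandermonde]
  simp [eigMatrix]
  ring

theorem isUnit_det_eigMatrix {α β m : ℝ} (hm : 0 < m) (hV : vandermonde α β m ≠ 0) (i : Fin 4) :
    IsUnit (eigMatrix α β i m).det := by
  rw [det_eigMatrix, isUnit_iff_ne_zero]
  have h : ∀ j, (eigNorm i m (charRoot α β m j) : ℂ) ≠ 0 := fun j => by
    exact_mod_cast (eigNorm_pos hm i _).ne'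
  exact div_ne_zero hV (mul_ne_zero (mul_ne_zero (h 0) (h 1)) (h 2))

theorem genMatrix_mul_eigMatrix {α : ℝ} (hα : α ≠ 0) (β : ℝ) (i : Fin 4) (m : ℝ) :
    genMatrix α β m * eigMatrix α β i m
      = eigMatrix α β i m * Matrix.diagonal (charRoot α β m) := by
  ext r j
  have h := congrFun (genMatrix_mulVec_eigenvector hα (charRoot_isRoot hα β m j)) r
  rw [Matrix.mul_diagonal, Matrix.mul_apply]
  simp only [Matrix.mulVec, dotProduct, Pi.smul_apply, smul_eq_mul] at h
  simp only [eigMatrix, Matrix.of_apply, mul_div_assoc']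
  rw [← Finset.sum_div, h]
  ring

theorem eigMatrix_inv_mul_genMatrix {α β m : ℝ} (hα : α ≠ 0) (hm : 0 < m)
    (hV : vandermonde α β m ≠ 0) (i : Fin 4) :
    (eigMatrix α β i m)⁻¹ * genMatrix α β m
      = Matrix.diagonal (charRoot α β m) * (eigMatrix α β i m)⁻¹ := by
  have hdet := isUnit_det_eigMatrix hm hV i
  have := congrArg (fun X => (eigMatrix α β i m)⁻¹ * X * (eigMatrix α β i m)⁻¹)
    (genMatrix_mul_eigMatrix hα β i m)
  rwa [← Matrix.mul_assoc _ (eigMatrix α β i m), Matrix.nonsing_inv_mul _ hdet, Matrix.one_mul,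
    ← Matrix.mul_assoc, Matrix.mul_assoc, Matrix.mul_nonsing_inv _ hdet, Matrix.mul_one] at this

theorem diagonal_dissipative {d : Fin 3 → ℂ} {σ : ℝ} (hσ : ∀ j, (d j).re ≤ σ) (y : Fin 3 → ℂ) :
    (star y ⬝ᵥ (Matrix.diagonal d *ᵥ y)).re ≤ σ * normSq₃ y := by
  have e : (star y ⬝ᵥ (Matrix.diagonal d *ᵥ y)).re = ∑ j, (d j).re * ‖y j‖ ^ 2 := by
    simp only [dotProduct, Matrix.mulVec_diagonal, Complex.re_sum]
    refine Finset.sum_congr rfl fun j _ => ?_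
    simp only [Complex.sq_norm, Complex.normSq_apply]
    simp
    ring
  rw [e, normSq₃, Finset.mul_sum]
  gcongr with j
  exact hσ j

/-- The normalization by `eigNorm` gives each column of the product Euclidean length one. -/
theorem sqrtDiag_mul_eigMatrix_le {m : ℝ} (hm : 0 < m) (α β : ℝ) (i : Fin 4) (r j : Fin 3) :
    ‖(sqrtDiag (weight i m) * eigMatrix α β i m) r j‖ ≤ 1 := by
  have hc := eigNorm_pos hm i (charRoot α β m j)
  rw [sqrtDiag, Matrix.diagonal_mul, eigMatrix, Matrix.of_apply, mul_div_assoc', norm_div,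
    Complex.norm_real, Real.norm_eq_abs, abs_of_pos hc, div_le_one hc]
  rw [← pow_le_pow_iff_left₀ (norm_nonneg _) hc.le two_ne_zero]
  rw [eigNorm_sq hm, norm_mul, mul_pow, Complex.norm_real, Real.norm_eq_abs, sq_abs,
    Real.sq_sqrt (weight_pos hm i r).le]
  exact Finset.single_le_sum (f := fun r => weight i m r * ‖charRoot α β m j ^ (r : ℕ)‖ ^ 2)
    (fun r _ => mul_nonneg (weight_pos hm i r).le (sq_nonneg _)) (Finset.mem_univ r)

/-- The easy half of the norm equivalence: the constant `9` does not depend on `m`. -/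
theorem weightedSq_le_of_eigMatrix {α β m : ℝ} (hm : 0 < m) (hV : vandermonde α β m ≠ 0)
    (i : Fin 4) (x : Fin 3 → ℂ) :
    weightedSq (weight i m) x ≤ 9 * normSq₃ ((eigMatrix α β i m)⁻¹ *ᵥ x) := by
  have h := normSq₃_mulVec_le (sqrtDiag_mul_eigMatrix_le hm α β i) ((eigMatrix α β i m)⁻¹ *ᵥ x)
  rw [Matrix.mulVec_mulVec, Matrix.mul_assoc,
    Matrix.mul_nonsing_inv _ (isUnit_det_eigMatrix hm hV i), Matrix.mul_one,
    ← weightedSq_eq fun r => (weight_pos hm i r).le] at h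
  simpa using h

/-- The hard half reduces to a lower bound for one determinant. -/
theorem normSq₃_eigMatrix_inv_le {α β m : ℝ} (hm : 0 < m) (hV : vandermonde α β m ≠ 0)
    (i : Fin 4) (x : Fin 3 → ℂ) :
    ‖(sqrtDiag (weight i m) * eigMatrix α β i m).det‖ ^ 2 *
      normSq₃ ((eigMatrix α β i m)⁻¹ *ᵥ x) ≤ 36 * weightedSq (weight i m) x := by
  have h := norm_det_sq_mul_normSq₃_le (sqrtDiag_mul_eigMatrix_le hm α β i)
    ((eigMatrix α β i m)⁻¹ *ᵥ x)
  rwa [Matrix.mulVec_mulVec, Matrix.mul_assoc (sqrtDiag _),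
    Matrix.mul_nonsing_inv _ (isUnit_det_eigMatrix hm hV i), Matrix.mul_one,
    ← weightedSq_eq fun r => (weight_pos hm i r).le] at h

theorem norm_det_sq_eq {m : ℝ} (hm : 0 < m) (α β : ℝ) (i : Fin 4) :
    ‖(sqrtDiag (weight i m) * eigMatrix α β i m).det‖ ^ 2 =
      (∏ r, weight i m r) * ‖vandermonde α β m‖ ^ 2
        / ∏ j, eigNorm i m (charRoot α β m j) ^ 2 := by
  have h1 : ‖(sqrtDiag (weight i m)).det‖ ^ 2 = ∏ r, weight i m r := by
    rw [sqrtDiag, Matrix.det_diagonal, norm_prod, ← Finset.prod_pow]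
    refine Finset.prod_congr rfl fun r _ => ?_
    rw [Complex.norm_real, Real.norm_eq_abs, sq_abs, Real.sq_sqrt (weight_pos hm i r).le]
  rw [Matrix.det_mul, norm_mul, mul_pow, h1, det_eigMatrix,
    Fin.prod_univ_three (f := fun j => _ ^ 2)]
  simp only [norm_div, norm_mul, Complex.norm_real, Real.norm_eq_abs, div_pow, mul_pow, sq_abs]
  ring

/-! ### Asymptotics for large eigenvalues -/

/-- For `|λ| > 1`, dividing the cubic by `|λ|` gives `α |λ|² ≤ |λ| + (β + 1) m`, and the linear term
is absorbed by the square. The summand `1` in the constant covers `|λ| ≤ 1`. -/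
theorem charRoot_norm_sq_le {α β m : ℝ} (hα : 0 < α) (hβ : 0 < β) (hm : 1 ≤ m) (j : Fin 3) :
    ‖charRoot α β m j‖ ^ 2 ≤ (1 + (2 * (β + 1) + 1 / α) / α) * m := by
  have hroot := charRoot_isRoot hα.ne' β m j
  set z := charRoot α β m j
  set l := ‖z‖
  have hl : 0 ≤ l := norm_nonneg z
  have h1 : α * l ^ 3 ≤ l ^ 2 + β * m * l + m := by
    have e : (α : ℂ) * z ^ 3 = -(z ^ 2 + β * m * z + m) := by linear_combination hroot
    have e2 := congrArg norm e
    rw [norm_mul, norm_pow, Complex.norm_real, Real.norm_eq_abs, abs_of_pos hα, norm_neg] at e2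
    rw [e2]
    refine (norm_add_le _ _).trans ?_
    gcongr
    · refine (norm_add_le _ _).trans ?_
      rw [norm_pow, norm_mul, norm_mul, Complex.norm_real, Complex.norm_real, Real.norm_eq_abs,
        Real.norm_eq_abs, abs_of_pos hβ, abs_of_pos (by linarith)]
    · rw [Complex.norm_real, Real.norm_eq_abs, abs_of_pos (by linarith)]
  have hK : 0 < (2 * (β + 1) + 1 / α) / α := by positivity
  rcases le_or_gt l 1 with h | h
  · nlinarith
  · have h2 : α * l ^ 2 ≤ l + (β + 1) * m := by
      have : l * (α * l ^ 2) ≤ l * (l + (β + 1) * m) := by nlinarith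
      exact le_of_mul_le_mul_left this (by linarith)
    have h3 : α ^ 2 * l ^ 2 ≤ (2 * α * (β + 1) + 1) * m := by
      nlinarith [sq_nonneg (α * l - 1)]
    have h4 : (2 * (β + 1) + 1 / α) / α = (2 * α * (β + 1) + 1) / α ^ 2 := by
      field_simp
    have h5 : l ^ 2 ≤ (2 * α * (β + 1) + 1) / α ^ 2 * m := by
      rw [div_mul_eq_mul_div, le_div_iff₀ (by positivity)]
      linarith
    rw [h4]
    nlinarith

/-- By Vieta the reciprocals of the roots sum to `-β`, so they cannot all have modulus below `β/3`.
-/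
theorem exists_charRoot_norm_le {α β m : ℝ} (hα : 0 < α) (hβ : 0 < β) (hm : 0 < m) :
    ∃ j, ‖charRoot α β m j‖ ≤ 3 / β := by
  obtain ⟨-, h2, h3⟩ := charRoot_vieta hα.ne' β m
  by_contra! h
  have h0 := h 0
  have h1 := h 1
  have h4 := h 2
  set a := charRoot α β m 0
  set b := charRoot α β m 1
  set c := charRoot α β m 2
  have hs : 0 < 3 / β := by positivity
  have n2 := congrArg norm h2
  have n3 := congrArg norm h3
  rw [norm_mul, norm_mul, Complex.norm_real, Complex.norm_real, Complex.norm_real,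
    Real.norm_eq_abs, Real.norm_eq_abs, Real.norm_eq_abs, abs_of_pos hα, abs_of_pos hβ,
    abs_of_pos hm] at n2
  rw [norm_mul, norm_mul, norm_mul, norm_neg, Complex.norm_real, Complex.norm_real,
    Real.norm_eq_abs, Real.norm_eq_abs, abs_of_pos hα, abs_of_pos hm] at n3
  have hsum : ‖a * b + a * c + b * c‖ ≤ ‖a‖ * ‖b‖ + ‖a‖ * ‖c‖ + ‖b‖ * ‖c‖ := by
    simpa only [norm_mul] using norm_add₃_le (a := a * b) (b := a * c) (c := b * c)
  have ha : 0 < ‖a‖ := hs.trans h0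
  have hb : 0 < ‖b‖ := hs.trans h1
  have hc : 0 < ‖c‖ := hs.trans h4
  have p1 : ‖a‖ * ‖b‖ * (3 / β) < ‖a‖ * ‖b‖ * ‖c‖ := by gcongr
  have p2 : ‖a‖ * ‖c‖ * (3 / β) < ‖a‖ * ‖c‖ * ‖b‖ := by gcongr
  have p3 : ‖b‖ * ‖c‖ * (3 / β) < ‖b‖ * ‖c‖ * ‖a‖ := by gcongr
  have p4 : (‖a‖ * ‖b‖ + ‖a‖ * ‖c‖ + ‖b‖ * ‖c‖) * (3 / β) < 3 * (‖a‖ * ‖b‖ * ‖c‖) := by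
    linarith
  rw [mul_div_assoc', div_lt_iff₀ hβ] at p4
  have p5 : α * (‖a‖ * ‖b‖ + ‖a‖ * ‖c‖ + ‖b‖ * ‖c‖) < α * (‖a‖ * ‖b‖ * ‖c‖ * β) := by
    apply mul_lt_mul_of_pos_left _ hα
    linarith
  have p6 : α * ‖a * b + a * c + b * c‖ ≤ α * (‖a‖ * ‖b‖ + ‖a‖ * ‖c‖ + ‖b‖ * ‖c‖) := by gcongr
  nlinarith

/-- Half of the leading term `4 α β³ m²` of the quadratic factor absorbs its linear term. -/
theorem norm_vandermonde_sq_ge {α β m : ℝ} (hα : 0 < α) (hm : 0 < m)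
    (hlarge : |27 * α ^ 2 - 18 * α * β - β ^ 2| ≤ 2 * α * β ^ 3 * m) :
    2 * β ^ 3 / α ^ 3 * m ^ 3 ≤ ‖vandermonde α β m‖ ^ 2 := by
  have h := congrArg norm (vandermonde_sq hα.ne' β m)
  have e : (-m * (4 * α * β ^ 3 * m ^ 2 + (27 * α ^ 2 - 18 * α * β - β ^ 2) * m + 4) : ℂ)
      = ((-m * (4 * α * β ^ 3 * m ^ 2 + (27 * α ^ 2 - 18 * α * β - β ^ 2) * m + 4) : ℝ) : ℂ) := by
    push_cast
    ring
  rw [e, norm_mul, norm_pow, norm_pow, Complex.norm_real, Complex.norm_real, Real.norm_eq_abs,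
    Real.norm_eq_abs, abs_of_pos hα, abs_mul, abs_neg, abs_of_pos hm] at h
  set k := 27 * α ^ 2 - 18 * α * β - β ^ 2
  have hk := neg_abs_le k
  have h1 : 2 * α * β ^ 3 * m ^ 2 ≤ |4 * α * β ^ 3 * m ^ 2 + k * m + 4| := by
    refine le_trans ?_ (le_abs_self _)
    nlinarith
  have h2 : m * (2 * α * β ^ 3 * m ^ 2) ≤ α ^ 4 * ‖vandermonde α β m‖ ^ 2 := by
    rw [h]
    gcongr
  rw [div_mul_eq_mul_div, div_le_iff₀ (by positivity)]
  have h3 : α * (2 * β ^ 3 * m ^ 3) ≤ α * (‖vandermonde α β m‖ ^ 2 * α ^ 3) := by linarith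
  exact le_of_mul_le_mul_left h3 hα

end MGT

/-! ### Uniform bounds for the normalized eigenvector matrices -/

namespace MGT

theorem prod_three_le {f : Fin 3 → ℝ} (hf : ∀ j, 0 ≤ f j) {p q : ℝ} (hq : ∀ j, f j ≤ q)
    {j : Fin 3} (hj : f j ≤ p) : ∏ k, f k ≤ p * q ^ 2 := by
  have key : ∀ a b c : ℝ, 0 ≤ a → 0 ≤ b → 0 ≤ c → a ≤ p → b ≤ q → c ≤ q →
      a * b * c ≤ p * q ^ 2 := by
    intro a b c ha hb hc hap hbq hcq
    have hp : 0 ≤ p := ha.trans hap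
    have hq0 : 0 ≤ q := hb.trans hbq
    calc a * b * c ≤ p * q * q := by gcongr
      _ = p * q ^ 2 := by ring
  rw [Fin.prod_univ_three]
  fin_cases j
  · exact key _ _ _ (hf 0) (hf 1) (hf 2) hj (hq 1) (hq 2)
  · rw [mul_comm (f 0)]
    exact key _ _ _ (hf 1) (hf 0) (hf 2) hj (hq 0) (hq 2)
  · rw [mul_comm, ← mul_assoc]
    exact key _ _ _ (hf 2) (hf 0) (hf 1) hj (hq 0) (hq 1)

/-- Here the choice of spaces enters. With `e` the last exponent, `|λ|² = O(m)` gives squared norms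
`O(m^(2+e))`. For exponents `(2+e, 1+e, e)` three such factors match the right side `m^(6+3e)`. For
`(1+e, 1+e, e)` the right side is only `m^(5+3e)`; the missing power is saved by the bounded root,
whose squared norm is `O(m^(1+e))`. -/
theorem exists_prod_eigNorm_le {α β : ℝ} (hα : 0 < α) (hβ : 0 < β) (i : Fin 4) :
    ∃ K > 0, ∀ m ≥ 1, ∏ j, eigNorm i m (charRoot α β m j) ^ 2
      ≤ K * ((∏ r, weight i m r) * m ^ 3) := by
  set K₁ := 1 + (2 * (β + 1) + 1 / α) / α
  have hK₁ : 0 < K₁ := by positivity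
  have hQ : 0 < 1 + K₁ + K₁ ^ 2 := by positivity
  have hP : 0 < 1 + (3 / β) ^ 2 + (3 / β) ^ 4 := by positivity
  set Q := 1 + K₁ + K₁ ^ 2 with hQdef
  set P := 1 + (3 / β) ^ 2 + (3 / β) ^ 4 with hPdef
  have hnorm : ∀ m ≥ 1, ∀ l : ℂ, eigNorm i m l ^ 2 =
      m ^ halfExp i 0 + m ^ halfExp i 1 * ‖l‖ ^ 2 + m ^ halfExp i 2 * ‖l‖ ^ 4 := by
    intro m hm l
    rw [eigNorm_sq (by linarith), weightedSq, Fin.sum_univ_three]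
    simp only [weight, norm_pow, norm_one, Nat.reduceMul, Fin.val_zero, Fin.val_one, Fin.val_two,
      pow_zero, pow_one, one_pow, mul_one, ← pow_mul]
  have hlarge : ∀ m ≥ 1, ∀ j, ‖charRoot α β m j‖ ^ 2 ≤ K₁ * m ∧
      ‖charRoot α β m j‖ ^ 4 ≤ K₁ ^ 2 * m ^ 2 := by
    intro m hm j
    have h := charRoot_norm_sq_le hα hβ hm j
    refine ⟨h, ?_⟩
    calc ‖charRoot α β m j‖ ^ 4 = (‖charRoot α β m j‖ ^ 2) ^ 2 := by ring
      _ ≤ (K₁ * m) ^ 2 := by gcongr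
      _ = K₁ ^ 2 * m ^ 2 := by ring
  have hsmall : ∀ m ≥ 1, ∃ j, ‖charRoot α β m j‖ ^ 2 ≤ (3 / β) ^ 2 ∧
      ‖charRoot α β m j‖ ^ 4 ≤ (3 / β) ^ 4 := by
    intro m hm
    obtain ⟨j, hj⟩ := exists_charRoot_norm_le hα hβ (m := m) (by linarith)
    exact ⟨j, by gcongr, by gcongr⟩
  have hall : ∀ e : ℕ, halfExp i 0 ≤ 2 + e → halfExp i 1 ≤ 1 + e → halfExp i 2 = e → ∀ m ≥ 1, ∀ j,
      eigNorm i m (charRoot α β m j) ^ 2 ≤ Q * m ^ (2 + e) := by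
    intro e h0 h1 h2 m hm j
    have hm0 : 0 ≤ m := by linarith
    obtain ⟨hl1, hl2⟩ := hlarge m hm j
    rw [hnorm m hm, h2]
    calc m ^ halfExp i 0 + m ^ halfExp i 1 * ‖charRoot α β m j‖ ^ 2
          + m ^ e * ‖charRoot α β m j‖ ^ 4
        ≤ m ^ (2 + e) + m ^ (1 + e) * (K₁ * m) + m ^ e * (K₁ ^ 2 * m ^ 2) := by gcongr
      _ = Q * m ^ (2 + e) := by rw [hQdef]; ring
  have hone : ∀ e : ℕ, halfExp i 0 = 1 + e → halfExp i 1 = 1 + e → halfExp i 2 = e → ∀ m ≥ 1, ∃ j,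
      eigNorm i m (charRoot α β m j) ^ 2 ≤ P * m ^ (1 + e) := by
    intro e h0 h1 h2 m hm
    have hm0 : 0 ≤ m := by linarith
    obtain ⟨j, hl1, hl2⟩ := hsmall m hm
    refine ⟨j, ?_⟩
    rw [hnorm m hm, h0, h1, h2]
    calc m ^ (1 + e) + m ^ (1 + e) * ‖charRoot α β m j‖ ^ 2 + m ^ e * ‖charRoot α β m j‖ ^ 4
        ≤ m ^ (1 + e) + m ^ (1 + e) * (3 / β) ^ 2 + m ^ (1 + e) * (3 / β) ^ 4 := by
          gcongr
          omega
      _ = P * m ^ (1 + e) := by rw [hPdef]; ring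
  have hweak : ∀ e : ℕ, halfExp i 0 = 1 + e → halfExp i 1 = 1 + e → halfExp i 2 = e →
      ∃ K > 0, ∀ m ≥ 1, ∏ j, eigNorm i m (charRoot α β m j) ^ 2
        ≤ K * ((∏ r, weight i m r) * m ^ 3) := by
    intro e h0 h1 h2
    refine ⟨P * Q ^ 2, by positivity, fun m hm => ?_⟩
    obtain ⟨j, hj⟩ := hone e h0 h1 h2 m hm
    refine (prod_three_le (fun _ => by positivity)
      (hall e (by omega) (by omega) h2 m hm) hj).trans (le_of_eq ?_)
    rw [Fin.prod_univ_three]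
    simp only [weight, h0, h1, h2]
    ring
  have hstrong : ∀ e : ℕ, halfExp i 0 = 2 + e → halfExp i 1 = 1 + e → halfExp i 2 = e →
      ∃ K > 0, ∀ m ≥ 1, ∏ j, eigNorm i m (charRoot α β m j) ^ 2
        ≤ K * ((∏ r, weight i m r) * m ^ 3) := by
    intro e h0 h1 h2
    refine ⟨Q ^ 3, by positivity, fun m hm => ?_⟩
    have hq := hall e (by omega) (by omega) h2 m hm
    refine (prod_three_le (fun _ => by positivity) hq (hq 0)).trans (le_of_eq ?_)
    rw [Fin.prod_univ_three]
    simp only [weight, h0, h1, h2]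
    ring
  fin_cases i
  · exact hweak 0 rfl rfl rfl
  · exact hweak 1 rfl rfl rfl
  · exact hstrong 0 rfl rfl rfl
  · exact hstrong 1 rfl rfl rfl

/-- For large `m` the inverses of the matrices of normalized eigenvectors are uniformly bounded. -/
theorem exists_eigMatrix_inv_bound {α β : ℝ} (hα : 0 < α) (hβ : 0 < β) (i : Fin 4) :
    ∃ C > 0, ∃ M, ∀ m ≥ M, ∀ x, normSq₃ ((eigMatrix α β i m)⁻¹ *ᵥ x)
      ≤ C * weightedSq (weight i m) x := by
  obtain ⟨K, hK, hprod⟩ := exists_prod_eigNorm_le hα hβ i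
  set k := |27 * α ^ 2 - 18 * α * β - β ^ 2|
  refine ⟨36 * (K / (2 * β ^ 3 / α ^ 3)), by positivity, max 1 (k / (2 * α * β ^ 3)), ?_⟩
  intro m hm x
  have hm1 : 1 ≤ m := (le_max_left _ _).trans hm
  have hm0 : 0 < m := by linarith
  have hk : k ≤ 2 * α * β ^ 3 * m := by
    have := (le_max_right _ _).trans hm
    rw [div_le_iff₀ (by positivity)] at this
    linarith
  have hvan := norm_vandermonde_sq_ge hα hm0 hk
  have hV : vandermonde α β m ≠ 0 := by
    intro h
    rw [h] at hvan
    have : 0 < 2 * β ^ 3 / α ^ 3 * m ^ 3 := by positivity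
    simp at hvan
    linarith
  have hw : 0 < ∏ r, weight i m r := Finset.prod_pos fun r _ => weight_pos hm0 i r
  have hc : 0 < ∏ j, eigNorm i m (charRoot α β m j) ^ 2 :=
    Finset.prod_pos fun j _ => pow_pos (eigNorm_pos hm0 i _) 2
  -- The product of the weights and the factor `m³` of the squared Vandermonde determinant cancel
  -- against the bound for the norms.
  have hdet : (2 * β ^ 3 / α ^ 3) / K ≤ ‖(sqrtDiag (weight i m) * eigMatrix α β i m).det‖ ^ 2 := by
    rw [norm_det_sq_eq hm0, div_le_div_iff₀ hK hc]
    calc 2 * β ^ 3 / α ^ 3 * ∏ j, eigNorm i m (charRoot α β m j) ^ 2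
        ≤ 2 * β ^ 3 / α ^ 3 * (K * ((∏ r, weight i m r) * m ^ 3)) := by
          gcongr
          exact hprod m hm1
      _ = (∏ r, weight i m r) * (2 * β ^ 3 / α ^ 3 * m ^ 3) * K := by ring
      _ ≤ (∏ r, weight i m r) * ‖vandermonde α β m‖ ^ 2 * K := by gcongr
  have h1 := normSq₃_eigMatrix_inv_le hm0 hV i x
  have h2 : (2 * β ^ 3 / α ^ 3) / K * normSq₃ ((eigMatrix α β i m)⁻¹ *ᵥ x)
      ≤ 36 * weightedSq (weight i m) x :=
    (mul_le_mul_of_nonneg_right hdet (normSq₃_nonneg _)).trans h1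
  rw [div_mul_eq_mul_div, div_le_iff₀ hK, mul_comm (2 * β ^ 3 / α ^ 3),
    ← le_div_iff₀ (by positivity)] at h2
  refine h2.trans (le_of_eq ?_)
  ring

end MGT

namespace MGT

variable {H : Type*} [NormedAddCommGroup H] [InnerProductSpace ℂ H]
  {φ : HilbertBasis ℕ ℂ H} {μ : ℕ → ℝ} {i : Fin 4}

/-! ### Coordinates in the phase space -/

theorem coord_add (U V : phaseSpace φ μ i) (n : ℕ) : coord (U + V) n = coord U n + coord V n := by
  ext r
  simp [coord, comp]

theorem coord_smul (c : ℂ) (U : phaseSpace φ μ i) (n : ℕ) : coord (c • U) n = c • coord U n := by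
  ext r
  simp [coord, comp]

theorem coord_sub (U V : phaseSpace φ μ i) (n : ℕ) : coord (U - V) n = coord U n - coord V n := by
  ext r
  simp [coord, comp]

theorem eq_of_forall_inner_eq {x y : H} (h : ∀ n, ⟪φ n, x⟫_ℂ = ⟪φ n, y⟫_ℂ) : x = y := by
  apply φ.repr.injective
  ext n
  rw [φ.repr_apply_apply, φ.repr_apply_apply, h]

theorem eq_of_coord_eq {U V : phaseSpace φ μ i} (h : ∀ n, coord U n = coord V n) : U = V := by
  apply Subtype.ext
  funext r
  exact eq_of_forall_inner_eq (φ := φ) fun n => congrFun (h n) r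

theorem mem_halfPowDomain_iff (hμ : ∀ n, 0 < μ n) (k : ℕ) (u : H) :
    u ∈ halfPowDomain φ μ k ↔ Summable fun n => μ n ^ k * ‖⟪φ n, u⟫_ℂ‖ ^ 2 := by
  change Memℓp (fun n => ((√(μ n) : ℝ) : ℂ) ^ k * ⟪φ n, u⟫_ℂ) 2 ↔ _
  rw [memℓp_gen_iff (by norm_num)]
  refine summable_congr fun n => ?_
  rw [ENNReal.toReal_ofNat, Real.rpow_two, norm_mul, norm_pow, Complex.norm_real, Real.norm_eq_abs,
    abs_of_nonneg (Real.sqrt_nonneg _), mul_pow, ← pow_mul, mul_comm k, pow_mul,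
    Real.sq_sqrt (hμ n).le]

theorem summable_weightedSq (hμ : ∀ n, 0 < μ n) (U : phaseSpace φ μ i) :
    Summable fun n => weightedSq (weight i (μ n)) (coord U n) := by
  unfold weightedSq
  refine summable_sum fun r _ => ?_
  exact (mem_halfPowDomain_iff hμ _ _).1 (U.2 r (Set.mem_univ r))

theorem natNormSq_eq (U : phaseSpace φ μ i) :
    natNormSq U = ∑' n, weightedSq (weight i (μ n)) (coord U n) := rfl

theorem weightedSq_nonneg {m : ℝ} (hm : 0 < m) (x : Fin 3 → ℂ) : 0 ≤ weightedSq (weight i m) x :=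
  Finset.sum_nonneg fun r _ => mul_nonneg (weight_pos hm i r).le (sq_nonneg _)

theorem le_weightedSq {m : ℝ} (hm : 0 < m) (x : Fin 3 → ℂ) (r : Fin 3) :
    weight i m r * ‖x r‖ ^ 2 ≤ weightedSq (weight i m) x :=
  Finset.single_le_sum (f := fun r => weight i m r * ‖x r‖ ^ 2)
    (fun r _ => mul_nonneg (weight_pos hm i r).le (sq_nonneg _)) (Finset.mem_univ r)

theorem weightedSq_smul (w : Fin 3 → ℝ) (c : ℂ) (x : Fin 3 → ℂ) :
    weightedSq w (c • x) = ‖c‖ ^ 2 * weightedSq w x := by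
  unfold weightedSq
  rw [Finset.mul_sum]
  refine Finset.sum_congr rfl fun r _ => ?_
  rw [Pi.smul_apply, smul_eq_mul, norm_mul]
  ring

theorem natNorm_smul (c : ℂ) (U : phaseSpace φ μ i) :
    natNorm (c • U) = ‖c‖ * natNorm U := by
  rw [natNorm, natNorm, natNormSq_eq, natNormSq_eq]
  simp only [coord_smul, weightedSq_smul]
  rw [tsum_mul_left, Real.sqrt_mul (sq_nonneg _), Real.sqrt_sq (norm_nonneg c)]

theorem norm_coord_le (hμ : ∀ n, 0 < μ n) (U : phaseSpace φ μ i) (n : ℕ) (r : Fin 3) :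
    ‖coord U n r‖ ≤ (√(weight i (μ n) r))⁻¹ * natNorm U := by
  have hw := weight_pos (hμ n) i r
  have h : weight i (μ n) r * ‖coord U n r‖ ^ 2 ≤ natNormSq U :=
    (le_weightedSq (hμ n) _ r).trans
      ((summable_weightedSq hμ U).le_tsum n fun k _ => weightedSq_nonneg (hμ k) _)
  rw [le_inv_mul_iff₀ (Real.sqrt_pos.2 hw), natNorm]
  apply Real.le_sqrt_of_sq_le
  rwa [mul_pow, Real.sq_sqrt hw.le]

theorem norm_sq_eq_tsum (φ : HilbertBasis ℕ ℂ H) (x : H) :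
    HasSum (fun n => ‖⟪φ n, x⟫_ℂ‖ ^ 2) (‖x‖ ^ 2) := by
  have h := Complex.hasSum_re (φ.hasSum_inner_mul_inner x x)
  convert h using 1
  · ext n
    rw [← inner_conj_symm x (φ n), Complex.conj_mul']
    norm_cast
  · exact (inner_self_eq_norm_sq (𝕜 := ℂ) x).symm

theorem norm_comp_le {m₀ : ℝ} (hm₀ : 0 < m₀) (hμ : ∀ n, m₀ ≤ μ n) (U : phaseSpace φ μ i)
    (r : Fin 3) : ‖comp U r‖ ≤ (√(weight i m₀ r))⁻¹ * natNorm U := by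
  have hpos : ∀ n, 0 < μ n := fun n => hm₀.trans_le (hμ n)
  have hw := weight_pos hm₀ i r
  rw [le_inv_mul_iff₀ (Real.sqrt_pos.2 hw), natNorm]
  apply Real.le_sqrt_of_sq_le
  rw [mul_pow, Real.sq_sqrt hw.le, natNormSq_eq, ← (norm_sq_eq_tsum φ (comp U r)).tsum_eq,
    ← tsum_mul_left]
  refine Summable.tsum_le_tsum (fun n => ?_) ((norm_sq_eq_tsum φ _).summable.mul_left _)
    (summable_weightedSq hpos U)
  refine le_trans ?_ (le_weightedSq (hpos n) _ r)
  have : weight i m₀ r ≤ weight i (μ n) r := by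
    unfold weight
    gcongr
    exact hμ n
  exact mul_le_mul_of_nonneg_right this (sq_nonneg _)

/-- Riesz–Fischer; the lower bound `m₀` makes weighted summability imply membership in `ℓ²`. -/
theorem exists_of_coord [CompleteSpace H] {m₀ : ℝ} (hm₀ : 0 < m₀) (hμ : ∀ n, m₀ ≤ μ n)
    {x : ℕ → Fin 3 → ℂ} (hx : Summable fun n => weightedSq (weight i (μ n)) (x n)) :
    ∃ U : phaseSpace φ μ i, ∀ n, coord U n = x n := by
  have hpos : ∀ n, 0 < μ n := fun n => hm₀.trans_le (hμ n)
  have hw : ∀ r, Summable fun n => weight i (μ n) r * ‖x n r‖ ^ 2 := fun r =>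
    hx.of_nonneg_of_le (fun n => mul_nonneg (weight_pos (hpos n) i r).le (sq_nonneg _))
      fun n => le_weightedSq (hpos n) _ r
  have hmem : ∀ r, Memℓp (fun n => x n r) 2 := by
    intro r
    rw [memℓp_gen_iff (by norm_num)]
    simp only [ENNReal.toReal_ofNat, Real.rpow_two]
    refine ((hw r).mul_left (weight i m₀ r)⁻¹).of_nonneg_of_le (fun n => sq_nonneg _) fun n => ?_
    rw [le_inv_mul_iff₀ (weight_pos hm₀ i r)]
    have : weight i m₀ r ≤ weight i (μ n) r := by
      unfold weight
      gcongr
      exact hμ n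
    exact mul_le_mul_of_nonneg_right this (sq_nonneg _)
  let u : Fin 3 → H := fun r => φ.repr.symm ⟨fun n => x n r, hmem r⟩
  have hu : ∀ r n, ⟪φ n, u r⟫_ℂ = x n r := by
    intro r n
    rw [← φ.repr_apply_apply, LinearIsometryEquiv.apply_symm_apply]
  refine ⟨⟨u, fun r _ => ?_⟩, fun n => funext fun r => hu r n⟩
  refine (mem_halfPowDomain_iff hpos _ _).2 ?_
  simp only [hu]
  exact hw r

/-- Every vector in `ℂ³` is the coordinate vector of an element of `Eₙ`. -/
theorem exists_mode [CompleteSpace H] (φ : HilbertBasis ℕ ℂ H) {m₀ : ℝ} (hm₀ : 0 < m₀)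
    (hμ : ∀ n, m₀ ≤ μ n) (i : Fin 4) (n : ℕ)
    (p : Fin 3 → ℂ) : ∃ U : phaseSpace φ μ i, ∀ k, coord U k = if k = n then p else 0 := by
  refine exists_of_coord hm₀ hμ ?_
  refine summable_of_ne_finset_zero (s := {n}) fun k hk => ?_
  rw [if_neg (by simpa using hk)]
  simp [weightedSq]

/-- The domain condition is automatic from the coefficients: they identify `L (u + β v)` with `-(α
V₂ + w)`, which lies in `H` because `V` is given in the phase space. -/
theorem genRel_iff [CompleteSpace H] {L : H →ₗ.[ℂ] H} (hφ : IsEigenbasis L φ μ)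
    (hself : IsSelfAdjoint L) {α : ℝ} (hα : α ≠ 0) (β : ℝ) (U V : phaseSpace φ μ i) :
    GenRel L α β U V ↔ ∀ n, coord V n = genMatrix α β (μ n) *ᵥ coord U n := by
  have hα' : (α : ℂ) ≠ 0 := by exact_mod_cast hα
  constructor
  · rintro ⟨h0, h1, h, h2⟩ n
    have hL := (hφ.apply_eq_iff hself _ _).1 ⟨h, rfl⟩ n
    ext r
    fin_cases r
    · simp [genMatrix, Matrix.mulVec, dotProduct, Fin.sum_univ_three, coord, h0]
    · simp [genMatrix, Matrix.mulVec, dotProduct, Fin.sum_univ_three, coord, h1]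
    · simp only [coord, Fin.reduceFinMk]
      rw [h2, inner_sub_right, inner_smul_right, inner_smul_right, hL, inner_add_right,
        inner_smul_right]
      simp [genMatrix, Matrix.mulVec, dotProduct, Fin.sum_univ_three, coord]
      field_simp
      ring
  · intro hUV
    have hr : ∀ n r, ⟪φ n, comp V r⟫_ℂ = (genMatrix α β (μ n) *ᵥ coord U n) r :=
      fun n r => congrFun (hUV n) r
    have h2 : ∃ h : comp U 0 + (β : ℂ) • comp U 1 ∈ L.domain,
        L ⟨comp U 0 + (β : ℂ) • comp U 1, h⟩ = -((α : ℂ) • comp V 2 + comp U 2) := by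
      rw [hφ.apply_eq_iff hself]
      intro n
      rw [inner_neg_right, inner_add_right, inner_smul_right, hr, inner_add_right, inner_smul_right]
      simp [genMatrix, Matrix.mulVec, dotProduct, Fin.sum_univ_three, coord]
      field_simp
      ring
    obtain ⟨h, hL⟩ := h2
    refine ⟨eq_of_forall_inner_eq (φ := φ) fun n => ?_, eq_of_forall_inner_eq (φ := φ) fun n => ?_,
      h, ?_⟩
    · rw [hr]
      simp [genMatrix, Matrix.mulVec, dotProduct, Fin.sum_univ_three, coord]
    · rw [hr]
      simp [genMatrix, Matrix.mulVec, dotProduct, Fin.sum_univ_three, coord]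
    · rw [hL, smul_neg, neg_smul, neg_neg, smul_add, smul_smul]
      push_cast
      rw [one_div_mul_cancel hα', one_smul]
      abel

/-! ### Block diagonal scalar products -/

/-- The block diagonal form whose block on `Eₙ` has the matrix `Sₙᴴ Sₙ`. -/
noncomputable def blockProd (S : ℕ → Matrix (Fin 3) (Fin 3) ℂ) (U V : phaseSpace φ μ i) : ℂ :=
  ∑' n, star (S n *ᵥ coord U n) ⬝ᵥ (S n *ᵥ coord V n)

/-- The norms given by the blocks are uniformly equivalent to the natural ones. -/
def IsUniform (i : Fin 4) (μ : ℕ → ℝ) (S : ℕ → Matrix (Fin 3) (Fin 3) ℂ) : Prop :=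
  ∃ c C, 0 < c ∧ 0 < C ∧ ∀ n x, c * weightedSq (weight i (μ n)) x ≤ normSq₃ (S n *ᵥ x) ∧
    normSq₃ (S n *ᵥ x) ≤ C * weightedSq (weight i (μ n)) x

theorem IsUniform.of_eventually (hμ : ∀ n, 0 < μ n) {S : ℕ → Matrix (Fin 3) (Fin 3) ℂ}
    (hS : ∀ n, IsUnit (S n).det) {c C : ℝ} (hc : 0 < c) (hC : 0 < C)
    (h : ∀ᶠ n in cofinite, ∀ x, c * weightedSq (weight i (μ n)) x ≤ normSq₃ (S n *ᵥ x) ∧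
      normSq₃ (S n *ᵥ x) ≤ C * weightedSq (weight i (μ n)) x) : IsUniform i μ S := by
  choose a A ha hA hb using fun n => exists_weightedSq_equiv (weight_pos (hμ n) i) (hS n)
  have hfin : {n | ¬ ∀ x, c * weightedSq (weight i (μ n)) x ≤ normSq₃ (S n *ᵥ x) ∧
      normSq₃ (S n *ᵥ x) ≤ C * weightedSq (weight i (μ n)) x}.Finite := h
  set s := hfin.toFinset with hs
  have hsum : ∀ f : ℕ → ℝ, (∀ n, 0 < f n) → ∀ n ∈ s, f n ≤ ∑ k ∈ s, f k := fun f hf n hn =>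
    Finset.single_le_sum (f := f) (fun k _ => (hf k).le) hn
  have h1 : 0 ≤ ∑ k ∈ s, (a k)⁻¹ := Finset.sum_nonneg fun k _ => (inv_pos.2 (ha k)).le
  have h2 : 0 ≤ ∑ k ∈ s, A k := Finset.sum_nonneg fun k _ => (hA k).le
  have hci : 0 < c⁻¹ := inv_pos.2 hc
  -- Sums over the finitely many remaining blocks replace a minimum and a maximum of their
  -- individual constants.
  refine ⟨(c⁻¹ + ∑ k ∈ s, (a k)⁻¹)⁻¹, C + ∑ k ∈ s, A k, by positivity, by positivity,
    fun n x => ?_⟩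
  have hw : 0 ≤ weightedSq (weight i (μ n)) x := weightedSq_nonneg (hμ n) x
  by_cases hn : n ∈ s
  · obtain ⟨l, u⟩ := hb n x
    constructor
    · refine le_trans (mul_le_mul_of_nonneg_right ?_ hw) l
      rw [inv_le_comm₀ (by positivity) (ha n)]
      linarith [hsum _ (fun k => inv_pos.2 (ha k)) n hn]
    · refine u.trans (mul_le_mul_of_nonneg_right ?_ hw)
      linarith [hsum _ hA n hn]
  · have hn' : ∀ x, c * weightedSq (weight i (μ n)) x ≤ normSq₃ (S n *ᵥ x) ∧
        normSq₃ (S n *ᵥ x) ≤ C * weightedSq (weight i (μ n)) x := by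
      simpa [hs] using hn
    obtain ⟨l, u⟩ := hn' x
    constructor
    · refine le_trans (mul_le_mul_of_nonneg_right ?_ hw) l
      rw [inv_le_comm₀ (by positivity) hc]
      linarith
    · refine u.trans (mul_le_mul_of_nonneg_right ?_ hw)
      linarith

theorem norm_star_dotProduct_le (x y : Fin 3 → ℂ) : ‖star x ⬝ᵥ y‖ ≤ normSq₃ x + normSq₃ y := by
  refine (norm_sum_le _ _).trans ?_
  rw [normSq₃, normSq₃, ← Finset.sum_add_distrib]
  gcongr with r
  rw [norm_mul, Pi.star_apply, norm_star]
  nlinarith [sq_nonneg (‖x r‖ - ‖y r‖), sq_nonneg ‖x r‖, sq_nonneg ‖y r‖]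

section BlockProd

variable {S : ℕ → Matrix (Fin 3) (Fin 3) ℂ}

theorem IsUniform.summable (hS : IsUniform i μ S) (hμ : ∀ n, 0 < μ n) (U : phaseSpace φ μ i) :
    Summable fun n => normSq₃ (S n *ᵥ coord U n) := by
  obtain ⟨c, C, hc, hC, h⟩ := hS
  exact ((summable_weightedSq hμ U).mul_left C).of_nonneg_of_le (fun n => normSq₃_nonneg _)
    fun n => (h n _).2

theorem IsUniform.summable_blockProd (hS : IsUniform i μ S) (hμ : ∀ n, 0 < μ n)
    (U V : phaseSpace φ μ i) :
    Summable fun n => star (S n *ᵥ coord U n) ⬝ᵥ (S n *ᵥ coord V n) :=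
  Summable.of_norm_bounded ((hS.summable hμ U).add (hS.summable hμ V))
    fun _ => norm_star_dotProduct_le _ _

theorem blockProd_self (U : phaseSpace φ μ i) :
    blockProd S U U = ((∑' n, normSq₃ (S n *ᵥ coord U n) : ℝ) : ℂ) := by
  simp only [blockProd, star_dotProduct_self]
  rw [Complex.ofReal_tsum]

theorem gNorm_blockProd (U : phaseSpace φ μ i) :
    gNorm (blockProd S) U = √(∑' n, normSq₃ (S n *ᵥ coord U n)) := by
  rw [gNorm, blockProd_self, Complex.ofReal_re]

theorem IsUniform.isScalarProduct (hS : IsUniform i μ S) (hμ : ∀ n, 0 < μ n) :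
    IsScalarProduct (blockProd (φ := φ) (μ := μ) (i := i) S) where
  add_right U V W := by
    simp only [blockProd, coord_add, Matrix.mulVec_add, dotProduct_add]
    exact (hS.summable_blockProd hμ U V).tsum_add (hS.summable_blockProd hμ U W)
  smul_right c U V := by
    simp only [blockProd, coord_smul, Matrix.mulVec_smul, dotProduct_smul, smul_eq_mul]
    exact tsum_mul_left
  conj_symm U V := by
    rw [blockProd, Complex.conj_tsum]
    refine tsum_congr fun n => ?_
    rw [← RCLike.star_def, Matrix.star_dotProduct, star_star]
  pos U hU := by
    have hsum := hS.summable hμ U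
    obtain ⟨c, C, hc, hC, h⟩ := hS
    rw [blockProd_self, Complex.ofReal_re]
    obtain ⟨n, hn⟩ : ∃ n, coord U n ≠ 0 := by
      by_contra! h0
      refine hU (eq_of_coord_eq fun n => ?_)
      rw [h0 n]
      ext r
      simp [coord, comp]
    refine hsum.tsum_pos (fun _ => normSq₃_nonneg _) n (lt_of_lt_of_le ?_ (h n _).1)
    obtain ⟨r, hr⟩ := Function.ne_iff.1 hn
    refine mul_pos hc (lt_of_lt_of_le ?_ (le_weightedSq (hμ n) _ r))
    exact mul_pos (weight_pos (hμ n) i r) (pow_pos (norm_pos_iff.2 hr) 2)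

theorem IsUniform.isEquivalent (hS : IsUniform i μ S) (hμ : ∀ n, 0 < μ n) :
    IsEquivalent (blockProd (φ := φ) (μ := μ) (i := i) S) := by
  have hsum := fun U : phaseSpace φ μ i => hS.summable hμ U
  obtain ⟨c, C, hc, hC, h⟩ := hS
  refine ⟨√c, √C, Real.sqrt_pos.2 hc, Real.sqrt_pos.2 hC, fun U => ?_⟩
  have hw := summable_weightedSq hμ U
  rw [gNorm_blockProd, natNorm, natNormSq_eq, ← Real.sqrt_mul hc.le, ← Real.sqrt_mul hC.le,
    ← tsum_mul_left, ← tsum_mul_left]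
  exact ⟨Real.sqrt_le_sqrt ((hw.mul_left c).tsum_le_tsum (fun n => (h n _).1) (hsum U)),
    Real.sqrt_le_sqrt ((hsum U).tsum_le_tsum (fun n => (h n _).2) (hw.mul_left C))⟩

theorem prodG_eq_blockProd (α β : ℝ) :
    prodG (φ := φ) (μ := μ) (i := i) α β = blockProd fun n => (eigMatrix α β i (μ n))⁻¹ := by
  funext U V
  refine tsum_congr fun n => ?_
  rw [blockG, ← Matrix.mulVec_mulVec, Matrix.star_mulVec, Matrix.dotProduct_mulVec,
    Matrix.dotProduct_mulVec]

end BlockProd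

end MGT

namespace MGT

variable {H : Type*} [NormedAddCommGroup H] [InnerProductSpace ℂ H]
  {φ : HilbertBasis ℕ ℂ H} {μ : ℕ → ℝ} {i : Fin 4} {L : H →ₗ.[ℂ] H} {α β : ℝ}

/-! ### The coordinates of solutions -/

theorem hasDerivWithinAt_mulVec (A : Matrix (Fin 3) (Fin 3) ℂ) {x : ℝ → Fin 3 → ℂ}
    {x' : Fin 3 → ℂ} {s : Set ℝ} {t : ℝ} (h : HasDerivWithinAt x x' s t) :
    HasDerivWithinAt (fun τ => A *ᵥ x τ) (A *ᵥ x') s t := by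
  rw [hasDerivWithinAt_pi] at h ⊢
  exact fun r => HasDerivWithinAt.fun_sum (u := Finset.univ) fun j _ => (h j).const_mul (A r j)

theorem IsClassicalSolution.hasDerivWithinAt_coord [CompleteSpace H] (hφ : IsEigenbasis L φ μ)
    (hself : IsSelfAdjoint L) (hα : α ≠ 0) (hμ : ∀ n, 0 < μ n) {U : ℝ → phaseSpace φ μ i}
    (hU : IsClassicalSolution L α β U) (n : ℕ) {t : ℝ} (ht : 0 ≤ t) :
    HasDerivWithinAt (fun s => coord (U s) n) (genMatrix α β (μ n) *ᵥ coord (U t) n)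
      (Set.Ici 0) t := by
  obtain ⟨V, -, hV⟩ := hU
  obtain ⟨hgen, hlim⟩ := hV t ht
  rw [← (genRel_iff hφ hself hα β _ _).1 hgen n, hasDerivWithinAt_pi]
  intro r
  rw [hasDerivWithinAt_iff_tendsto_slope, tendsto_iff_norm_sub_tendsto_zero]
  have h0 := hlim.const_mul (√(weight i (μ n) r))⁻¹
  rw [mul_zero] at h0
  refine squeeze_zero (fun _ => norm_nonneg _) (fun s => ?_) h0
  refine le_trans (le_of_eq ?_) (norm_coord_le hμ _ n r)
  rw [coord_sub, coord_smul, coord_sub, slope_def_module]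
  congr 1
  simp [Complex.real_smul]

theorem ContinuousPath.continuousOn_comp {m₀ : ℝ} (hm₀ : 0 < m₀) (hμ : ∀ n, m₀ ≤ μ n)
    {U : ℝ → phaseSpace φ μ i} (hU : ContinuousPath U) (r : Fin 3) :
    ContinuousOn (fun s => comp (U s) r) (Set.Ici 0) := by
  intro t ht
  rw [ContinuousWithinAt, tendsto_iff_norm_sub_tendsto_zero]
  have h0 := (hU t ht).const_mul (√(weight i m₀ r))⁻¹
  rw [mul_zero] at h0
  refine squeeze_zero (fun _ => norm_nonneg _) (fun s => ?_) h0
  exact norm_comp_le hm₀ hμ (U s - U t) r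

/-- In coordinates the mild equation is `x(t) = x(0) + M ∫₀ᵗ x` with continuous `x`, so the
fundamental theorem of calculus makes every block a classical linear system. -/
theorem IsSolution.hasDerivWithinAt_coord [CompleteSpace H] (hφ : IsEigenbasis L φ μ)
    (hself : IsSelfAdjoint L) (hα : α ≠ 0) {m₀ : ℝ} (hm₀ : 0 < m₀) (hμ : ∀ n, m₀ ≤ μ n)
    {U : ℝ → phaseSpace φ μ i} (hU : IsSolution L α β U) (n : ℕ) {t : ℝ} (ht : 0 ≤ t) :
    HasDerivWithinAt (fun s => coord (U s) n) (genMatrix α β (μ n) *ᵥ coord (U t) n)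
      (Set.Ici 0) t := by
  obtain ⟨hcont, hmild⟩ := hU
  have hc := fun r => hcont.continuousOn_comp hm₀ hμ r
  -- Extending by the value at `0` to negative times makes the integrand continuous on `ℝ`, so its
  -- primitive is differentiable at `t = 0` too.
  let f : Fin 3 → ℝ → ℂ := fun r s => coord (U (max s 0)) n r
  have hf : ∀ r, Continuous (f r) := by
    intro r
    have h1 : Continuous fun s : ℝ => comp (U (max s 0)) r :=
      (hc r).comp_continuous (by fun_prop) fun s => le_max_right s 0
    exact continuous_const.inner h1
  let F : ℝ → Fin 3 → ℂ := fun s r => ∫ x in (0 : ℝ)..s, f r x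
  have hF : HasDerivAt F (coord (U t) n) t := by
    rw [hasDerivAt_pi]
    intro r
    have h1 := (hf r).integral_hasStrictDerivAt 0 t
    have h2 : f r t = coord (U t) n r := by simp only [f, max_eq_left ht]
    rw [← h2]
    exact h1.hasDerivAt
  have hM := hasDerivWithinAt_mulVec (genMatrix α β (μ n)) (hF.hasDerivWithinAt (s := Set.Ici 0))
  have hsol : ∀ s ∈ Set.Ici (0 : ℝ),
      coord (U s) n = coord (U 0) n + genMatrix α β (μ n) *ᵥ F s := by
    intro s hs
    obtain ⟨V, hV, hgen⟩ := hmild s hs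
    have h1 := (genRel_iff hφ hself hα β _ _).1 hgen n
    have h2 : coord V n = F s := by
      ext r
      have hintg : IntervalIntegrable (fun x => comp (U x) r) MeasureTheory.volume 0 s := by
        apply ContinuousOn.intervalIntegrable
        rw [Set.uIcc_of_le hs]
        exact (hc r).mono Set.Icc_subset_Ici_self
      have h3 := (innerSL ℂ (φ n)).intervalIntegral_comp_comm hintg
      change ⟪φ n, comp V r⟫_ℂ = _
      rw [hV r]
      refine h3.symm.trans (intervalIntegral.integral_congr fun x hx => ?_)
      rw [Set.uIcc_of_le hs] at hx
      simp only [f, max_eq_left hx.1]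
      rfl
    rw [← h2, ← h1, coord_sub]
    abel
  exact (hM.const_add (coord (U 0) n)).congr hsol (hsol t ht)

/-! ### The decay estimate -/

/-- For `y = S x` one has `y' = B y` and `(‖y‖²)' = 2 Re ⟨y, B y⟩ ≤ 2 σ ‖y‖²`, so `e^{-2σt} ‖y‖²` is
nonincreasing. -/
theorem normSq₃_le_exp_mul {M S B : Matrix (Fin 3) (Fin 3) ℂ} {σ : ℝ} (hSM : S * M = B * S)
    (hB : ∀ y, (star y ⬝ᵥ (B *ᵥ y)).re ≤ σ * normSq₃ y) {x : ℝ → Fin 3 → ℂ}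
    (hx : ∀ t ≥ 0, HasDerivWithinAt x (M *ᵥ x t) (Set.Ici 0) t) {t : ℝ} (ht : 0 ≤ t) :
    normSq₃ (S *ᵥ x t) ≤ Real.exp (2 * σ * t) * normSq₃ (S *ᵥ x 0) := by
  have hy : ∀ t ≥ 0, HasDerivWithinAt (fun s => S *ᵥ x s) (B *ᵥ (S *ᵥ x t)) (Set.Ici 0) t := by
    intro t ht
    rw [Matrix.mulVec_mulVec, ← hSM, ← Matrix.mulVec_mulVec]
    exact hasDerivWithinAt_mulVec S (hx t ht)
  set y := fun s => S *ᵥ x s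
  have hq : ∀ t ≥ 0, HasDerivWithinAt (fun s => normSq₃ (y s))
      (2 * (star (y t) ⬝ᵥ (B *ᵥ y t)).re) (Set.Ici 0) t := by
    intro t ht
    have h1 := fun r => ((hasDerivWithinAt_pi.1 (hy t ht)) r).norm_sq
    have h2 : HasDerivWithinAt (fun s => normSq₃ (y s)) _ (Set.Ici 0) t :=
      HasDerivWithinAt.fun_sum (u := Finset.univ) fun r _ => h1 r
    refine h2.congr_deriv ?_
    symm
    rw [← Finset.mul_sum, dotProduct, Complex.re_sum]
    congr 1
    refine Finset.sum_congr rfl fun r _ => ?_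
    change _ = ⟪y t r, (B *ᵥ y t) r⟫_ℝ
    rw [Complex.inner, Pi.star_apply, RCLike.star_def, mul_comm]
  have hh : ∀ t ≥ 0, HasDerivWithinAt (fun s => Real.exp (-(2 * σ) * s) * normSq₃ (y s))
      (Real.exp (-(2 * σ) * t) * (-(2 * σ)) * normSq₃ (y t)
        + Real.exp (-(2 * σ) * t) * (2 * (star (y t) ⬝ᵥ (B *ᵥ y t)).re)) (Set.Ici 0) t := by
    intro t ht
    have he : HasDerivAt (fun s => Real.exp (-(2 * σ) * s))
        (Real.exp (-(2 * σ) * t) * (-(2 * σ))) t := by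
      simpa using ((hasDerivAt_id t).const_mul (-(2 * σ))).exp
    exact he.hasDerivWithinAt.mul (hq t ht)
  have hanti : AntitoneOn (fun s => Real.exp (-(2 * σ) * s) * normSq₃ (y s)) (Set.Ici 0) := by
    refine antitoneOn_of_hasDerivWithinAt_nonpos (convex_Ici 0)
      (fun t ht => (hh t ht).continuousWithinAt)
      (fun t ht => (hh t (interior_subset ht)).mono interior_subset) fun t ht => ?_
    have h1 := hB (y t)
    have h2 := Real.exp_pos (-(2 * σ) * t)
    have h3 : Real.exp (-(2 * σ) * t) * (2 * ((star (y t) ⬝ᵥ (B *ᵥ y t)).re - σ * normSq₃ (y t)))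
        ≤ 0 := mul_nonpos_of_nonneg_of_nonpos h2.le (by linarith)
    linarith
  have h := hanti (Set.mem_Ici.2 le_rfl) (Set.mem_Ici.2 ht) ht
  simp only [mul_zero, Real.exp_zero, one_mul] at h
  rw [neg_mul, Real.exp_neg, inv_mul_le_iff₀ (Real.exp_pos _)] at h
  exact h

theorem IsUniform.decayEstimate [CompleteSpace H] {S B : ℕ → Matrix (Fin 3) (Fin 3) ℂ}
    (hS : IsUniform i μ S) (hφ : IsEigenbasis L φ μ) (hself : IsSelfAdjoint L) (hα : α ≠ 0)
    {m₀ : ℝ} (hm₀ : 0 < m₀) (hμ : ∀ n, m₀ ≤ μ n)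
    (hSM : ∀ n, S n * genMatrix α β (μ n) = B n * S n)
    (hB : ∀ n y, (star y ⬝ᵥ (B n *ᵥ y)).re ≤ sigmaMax μ α β * normSq₃ y) :
    DecayEstimate L α β (blockProd (φ := φ) (μ := μ) (i := i) S) := by
  have hpos : ∀ n, 0 < μ n := fun n => hm₀.trans_le (hμ n)
  intro U hU t ht
  have hderiv : ∀ n, ∀ t ≥ 0, HasDerivWithinAt (fun s => coord (U s) n)
      (genMatrix α β (μ n) *ᵥ coord (U t) n) (Set.Ici 0) t := by
    intro n t ht
    rcases hU with hU | hU
    · exact hU.hasDerivWithinAt_coord hφ hself hα hm₀ hμ n ht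
    · exact hU.hasDerivWithinAt_coord hφ hself hα hpos n ht
  have hle := fun n => normSq₃_le_exp_mul (hSM n) (hB n) (hderiv n) ht
  have hexp : Real.exp (sigmaMax μ α β * t) = √(Real.exp (2 * sigmaMax μ α β * t)) := by
    rw [← Real.exp_half]
    congr 1
    ring
  rw [gNorm_blockProd, gNorm_blockProd, hexp, ← Real.sqrt_mul (Real.exp_pos _).le, ← tsum_mul_left]
  exact Real.sqrt_le_sqrt ((hS.summable hpos (U t)).tsum_le_tsum hle
    ((hS.summable hpos (U 0)).mul_left _))

/-! ### Optimality -/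

theorem exists_eigenvector [CompleteSpace H] (hφ : IsEigenbasis L φ μ) (hself : IsSelfAdjoint L)
    (hα : α ≠ 0) {m₀ : ℝ} (hm₀ : 0 < m₀) (hμ : ∀ n, m₀ ≤ μ n) (i : Fin 4) {n : ℕ} {z : ℂ}
    (hz : (α : ℂ) * z ^ 3 + z ^ 2 + β * μ n * z + μ n = 0) :
    ∃ E : phaseSpace φ μ i, E ≠ 0 ∧ GenRel L α β E (z • E) := by
  obtain ⟨E, hE⟩ := exists_mode φ hm₀ hμ i n (fun r => z ^ (r : ℕ))
  refine ⟨E, ?_, ?_⟩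
  · rintro rfl
    have := congrFun (hE n) 0
    simp [coord, comp] at this
  · rw [genRel_iff hφ hself hα]
    intro k
    rw [coord_smul, hE k]
    split_ifs with h
    · rw [h, genMatrix_mulVec_eigenvector hα hz]
    · simp

theorem GenRel.smul [CompleteSpace H] (hφ : IsEigenbasis L φ μ) (hself : IsSelfAdjoint L)
    (hα : α ≠ 0) {U V : phaseSpace φ μ i} (h : GenRel L α β U V) (c : ℂ) :
    GenRel L α β (c • U) (c • V) := by
  rw [genRel_iff hφ hself hα] at h ⊢
  intro n
  rw [coord_smul, coord_smul, h n, Matrix.mulVec_smul]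

theorem continuousPath_smul {f : ℝ → ℂ} (hf : Continuous f) (E : phaseSpace φ μ i) :
    ContinuousPath fun t => f t • E := by
  intro t₀ _
  have h : Tendsto (fun t => ‖f t - f t₀‖ * natNorm E) (𝓝[Set.Ici 0] t₀) (𝓝 (0 * natNorm E)) := by
    refine Tendsto.mul_const _ ?_
    rw [← tendsto_iff_norm_sub_tendsto_zero]
    exact hf.continuousWithinAt
  rw [zero_mul] at h
  refine h.congr fun t => ?_
  rw [← natNorm_smul]
  congr 1
  module

theorem isSolution_exp [CompleteSpace H] (hφ : IsEigenbasis L φ μ) (hself : IsSelfAdjoint L)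
    (hα : α ≠ 0) {z : ℂ} (hz : z ≠ 0) {E : phaseSpace φ μ i} (hE : GenRel L α β E (z • E)) :
    IsSolution L α β fun t => Complex.exp (z * t) • E := by
  refine ⟨continuousPath_smul (by fun_prop) E, fun t _ => ?_⟩
  refine ⟨((Complex.exp (z * t) - 1) / z) • E, fun r => ?_, ?_⟩
  · have h1 : ∀ (c : ℂ), comp (c • E) r = c • comp E r := fun c => rfl
    simp only [h1]
    rw [intervalIntegral.integral_smul_const, integral_exp_mul_complex hz]
    simp
  · have := GenRel.smul hφ hself hα hE ((Complex.exp (z * t) - 1) / z)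
    rw [smul_smul, div_mul_cancel₀ _ hz, sub_smul, one_smul] at this
    simpa using this

theorem isClassicalSolution_exp [CompleteSpace H] (hφ : IsEigenbasis L φ μ)
    (hself : IsSelfAdjoint L) (hα : α ≠ 0) {z : ℂ} {E : phaseSpace φ μ i}
    (hE : GenRel L α β E (z • E)) :
    IsClassicalSolution L α β fun t => Complex.exp (z * t) • E := by
  refine ⟨fun t => (Complex.exp (z * t) * z) • E, continuousPath_smul (by fun_prop) E,
    fun t _ => ⟨?_, ?_⟩⟩
  · simp only [mul_smul]
    exact GenRel.smul hφ hself hα hE _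
  · have hd : HasDerivAt (fun s : ℝ => Complex.exp (z * s)) (Complex.exp (z * t) * z) t := by
      have h1 : HasDerivAt (fun s : ℝ => z * (s : ℂ)) z t := by
        simpa using (Complex.ofRealCLM.hasDerivAt (x := t)).const_mul z
      exact h1.cexp
    have h2 := (hasDerivAt_iff_tendsto_slope.1 hd).mono_left
      (nhdsWithin_mono t (fun s hs => hs.2 : Set.Ici 0 \ {t} ⊆ {t}ᶜ))
    rw [tendsto_iff_norm_sub_tendsto_zero] at h2
    have h3 := h2.mul_const (natNorm E)
    rw [zero_mul] at h3
    refine h3.congr fun s => ?_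
    rw [← natNorm_smul, slope_def_module, Complex.real_smul, Complex.ofReal_inv]
    congr 1
    module

theorem gNorm_smul {g : phaseSpace φ μ i → phaseSpace φ μ i → ℂ} (hg : IsScalarProduct g) (c : ℂ)
    (U : phaseSpace φ μ i) : gNorm g (c • U) = ‖c‖ * gNorm g U := by
  have h1 : g (c • U) (c • U) = ((‖c‖ ^ 2 : ℝ) : ℂ) * g U U := by
    rw [hg.smul_right, ← hg.conj_symm, hg.smul_right, map_mul, hg.conj_symm, ← mul_assoc,
      Complex.mul_conj']
    norm_cast
  rw [gNorm, gNorm, h1, Complex.re_ofReal_mul, Real.sqrt_mul (sq_nonneg _),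
    Real.sqrt_sq (norm_nonneg c)]

/-- The supremum need not be attained: a root with real part above `ω` suffices, and its exponential
solution works for every scalar product. -/
theorem IsScalarProduct.decayOptimal [CompleteSpace H]
    {g : phaseSpace φ μ i → phaseSpace φ μ i → ℂ} (hg : IsScalarProduct g)
    (hφ : IsEigenbasis L φ μ) (hself : IsSelfAdjoint L) (hα : α ≠ 0) {m₀ : ℝ} (hm₀ : 0 < m₀)
    (hμ : ∀ n, m₀ ≤ μ n) (hLUB : IsLUB (realParts μ α β) (sigmaMax μ α β)) :
    DecayOptimal L α β g := by
  intro ω hω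
  obtain ⟨x, ⟨n, z, hz, rfl⟩, hx, -⟩ := hLUB.exists_between hω
  obtain ⟨E, hE0, hE⟩ := exists_eigenvector hφ hself hα hm₀ hμ i hz
  have hz0 : z ≠ 0 := by
    rintro rfl
    have : (μ n : ℂ) = 0 := by simpa using hz
    have h0 : μ n = 0 := by exact_mod_cast this
    linarith [hμ n]
  refine ⟨fun t => Complex.exp (z * t) • E, isSolution_exp hφ hself hα hz0 hE,
    isClassicalSolution_exp hφ hself hα hE, ?_⟩
  have hEpos : 0 < gNorm g E := Real.sqrt_pos.2 (hg.pos E hE0)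
  have h : Tendsto (fun t : ℝ => gNorm g E * Real.exp ((z.re - ω) * t)) atTop atTop :=
    Tendsto.const_mul_atTop hEpos
      (Real.tendsto_exp_atTop.comp (tendsto_id.const_mul_atTop (sub_pos.2 hx)))
  refine h.congr fun t => ?_
  rw [gNorm_smul hg, Complex.norm_exp, Complex.re_mul_ofReal, mul_comm (Real.exp _), mul_assoc,
    ← Real.exp_add]
  ring_nf

/-! ### Normality -/

/-- The map sending `U` to the sequence `S n *ᵥ coord U n` is unitary onto `ℓ²(ℂ³)` and turns `A`
into multiplication by the diagonals `d n`. The adjoint is multiplication by their conjugates, with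
the same domain and norms. -/
theorem isNormal_blockProd [CompleteSpace H] {S : ℕ → Matrix (Fin 3) (Fin 3) ℂ}
    {d : ℕ → Fin 3 → ℂ} (hS : IsUniform i μ S) (hdet : ∀ n, IsUnit (S n).det)
    (hφ : IsEigenbasis L φ μ) (hself : IsSelfAdjoint L) (hα : α ≠ 0) {m₀ : ℝ} (hm₀ : 0 < m₀)
    (hμ : ∀ n, m₀ ≤ μ n) (hSM : ∀ n, S n * genMatrix α β (μ n) = Matrix.diagonal (d n) * S n) :
    IsNormal L α β (blockProd (φ := φ) (μ := μ) (i := i) S) := by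
  have hpos : ∀ n, 0 < μ n := fun n => hm₀.trans_le (hμ n)
  have hsum := fun U : phaseSpace φ μ i => hS.summable hpos U
  have hgen := fun U V : phaseSpace φ μ i => genRel_iff hφ hself hα β U V
  have hex : ∀ y : ℕ → Fin 3 → ℂ, Summable (fun n => normSq₃ (y n)) →
      ∃ U : phaseSpace φ μ i, ∀ n, S n *ᵥ coord U n = y n := by
    obtain ⟨c, C, hc, hC, h⟩ := hS
    intro y hy
    have hSy : ∀ n, S n *ᵥ ((S n)⁻¹ *ᵥ y n) = y n := fun n => by
      rw [Matrix.mulVec_mulVec, Matrix.mul_nonsing_inv _ (hdet n), Matrix.one_mulVec]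
    obtain ⟨U, hU⟩ := exists_of_coord (φ := φ) (i := i) hm₀ hμ (x := fun n => (S n)⁻¹ *ᵥ y n) <| by
      refine (hy.mul_left c⁻¹).of_nonneg_of_le (fun n => weightedSq_nonneg (hpos n) _) fun n => ?_
      rw [le_inv_mul_iff₀ hc]
      have := (h n ((S n)⁻¹ *ᵥ y n)).1
      rwa [hSy] at this
    exact ⟨U, fun n => by rw [hU, hSy]⟩
  have hinj : ∀ n x y, S n *ᵥ x = S n *ᵥ y → x = y := by
    intro n x y h
    have := congrArg ((S n)⁻¹ *ᵥ ·) h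
    simpa [Matrix.mulVec_mulVec, Matrix.nonsing_inv_mul _ (hdet n)] using this
  have hgen' : ∀ U V : phaseSpace φ μ i, GenRel L α β U V ↔
      ∀ n, S n *ᵥ coord V n = Matrix.diagonal (d n) *ᵥ (S n *ᵥ coord U n) := by
    intro U V
    rw [hgen]
    refine forall_congr' fun n => ?_
    rw [Matrix.mulVec_mulVec, ← hSM, ← Matrix.mulVec_mulVec]
    exact ⟨fun h => by rw [h], fun h => hinj n _ _ h⟩
  have hstar : ∀ n (y u : Fin 3 → ℂ), star y ⬝ᵥ (Matrix.diagonal (d n) *ᵥ u)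
      = star (Matrix.diagonal (star (d n)) *ᵥ y) ⬝ᵥ u := by
    intro n y u
    simp only [dotProduct, Matrix.mulVec_diagonal, Pi.star_apply, star_mul, star_star]
    exact Finset.sum_congr rfl fun r _ => by ring
  have hadj : ∀ Y Z : phaseSpace φ μ i, AdjRel L α β (blockProd S) Y Z ↔
      ∀ n, S n *ᵥ coord Z n = Matrix.diagonal (star (d n)) *ᵥ (S n *ᵥ coord Y n) := by
    intro Y Z
    constructor
    · intro h n
      set y := S n *ᵥ coord Y n
      set z := S n *ᵥ coord Z n
      -- Testing the adjoint relation with the single-block vector `p`, the defect itself, gives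
      -- `‖p‖² = 0`.
      set p := z - Matrix.diagonal (star (d n)) *ᵥ y with hp
      have single : ∀ q : Fin 3 → ℂ, ∃ U : phaseSpace φ μ i,
          ∀ k, S k *ᵥ coord U k = if k = n then q else 0 := fun q =>
        hex _ (summable_of_ne_finset_zero (s := {n}) fun k hk => by
          rw [if_neg (by simpa using hk)]; simp [normSq₃])
      obtain ⟨U, hU⟩ := single p
      obtain ⟨V, hV⟩ := single (Matrix.diagonal (d n) *ᵥ p)
      have hUV : GenRel L α β U V := by
        rw [hgen']
        intro k
        rw [hU, hV]
        split_ifs with hk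
        · rw [hk]
        · simp
      have hblock : ∀ (X W : phaseSpace φ μ i) (q : Fin 3 → ℂ),
          (∀ k, S k *ᵥ coord W k = if k = n then q else 0) →
          blockProd S X W = star (S n *ᵥ coord X n) ⬝ᵥ q := by
        intro X W q hW
        rw [blockProd, tsum_eq_single n]
        · rw [hW, if_pos rfl]
        · intro k hk
          rw [hW, if_neg hk, dotProduct_zero]
      have h1 := h U V hUV
      rw [hblock Y V _ hV, hblock Z U _ hU, hstar] at h1
      have h2 : star p ⬝ᵥ p = 0 := by
        conv_lhs => enter [1]; rw [hp]
        rw [star_sub, sub_dotProduct, h1, sub_self]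
      rw [star_dotProduct_self] at h2
      have h3 : normSq₃ p = 0 := by exact_mod_cast h2
      exact sub_eq_zero.1 (normSq₃_eq_zero.1 h3)
    · intro h U V hUV
      rw [hgen'] at hUV
      refine tsum_congr fun n => ?_
      rw [hUV, h, hstar]
  have hnorm : ∀ n (y : Fin 3 → ℂ), normSq₃ (Matrix.diagonal (star (d n)) *ᵥ y)
      = normSq₃ (Matrix.diagonal (d n) *ᵥ y) := by
    intro n y
    simp [normSq₃, Matrix.mulVec_diagonal]
  refine ⟨?_, ?_, ?_⟩
  · intro U ε hε
    -- Truncations to finitely many modes lie in the domain and are dense.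
    have htail := tendsto_sum_nat_add fun n => normSq₃ (S n *ᵥ coord U n)
    obtain ⟨N, hN⟩ := (htail.eventually_lt_const (show (0 : ℝ) < ε ^ 2 by positivity)).exists
    have trunc : ∀ y : ℕ → Fin 3 → ℂ, ∃ V : phaseSpace φ μ i,
        ∀ k, S k *ᵥ coord V k = if k < N then y k else 0 := fun y =>
      hex _ (summable_of_ne_finset_zero (s := Finset.range N) fun k hk => by
        rw [if_neg (by simpa using hk)]; simp [normSq₃])
    obtain ⟨V, hV⟩ := trunc fun n => S n *ᵥ coord U n
    obtain ⟨W, hW⟩ := trunc fun n => Matrix.diagonal (d n) *ᵥ (S n *ᵥ coord U n)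
    refine ⟨V, W, ?_, ?_⟩
    · rw [hgen']
      intro n
      rw [hV, hW]
      split_ifs
      · rfl
      · simp
    · rw [gNorm_blockProd, Real.sqrt_lt' hε]
      refine lt_of_le_of_lt (le_of_eq ?_) hN
      have hterm : ∀ n, normSq₃ (S n *ᵥ coord (U - V) n)
          = if n < N then 0 else normSq₃ (S n *ᵥ coord U n) := by
        intro n
        rw [coord_sub, Matrix.mulVec_sub, hV]
        split_ifs
        · simp [normSq₃]
        · simp
      rw [← (hsum (U - V)).sum_add_tsum_nat_add N, Finset.sum_eq_zero, zero_add]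
      · refine tsum_congr fun n => ?_
        rw [hterm, if_neg (by omega)]
      · intro n hn
        rw [hterm, if_pos (Finset.mem_range.1 hn)]
  · intro Y
    constructor
    · rintro ⟨V, hV⟩
      rw [hgen'] at hV
      obtain ⟨Z, hZ⟩ := hex (fun n => Matrix.diagonal (star (d n)) *ᵥ (S n *ᵥ coord Y n)) <| by
        simp only [hnorm, ← hV]
        exact hsum V
      exact ⟨Z, (hadj Y Z).2 hZ⟩
    · rintro ⟨Z, hZ⟩
      rw [hadj] at hZ
      obtain ⟨V, hV⟩ := hex (fun n => Matrix.diagonal (d n) *ᵥ (S n *ᵥ coord Y n)) <| by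
        simp only [← hnorm, ← hZ]
        exact hsum Z
      exact ⟨V, (hgen' Y V).2 hV⟩
  · intro Y V Z hV hZ
    rw [hgen'] at hV
    rw [hadj] at hZ
    simp only [gNorm_blockProd, hV, hZ, hnorm]

/-- An operator with a Jordan chain of length two is not normal for any scalar product. -/
theorem IsScalarProduct.not_isNormal {g : phaseSpace φ μ i → phaseSpace φ μ i → ℂ}
    (hg : IsScalarProduct g) {a : ℂ} {P Q : phaseSpace φ μ i} (hP0 : P ≠ 0)
    (hP : GenRel L α β P (a • P)) (hQ : GenRel L α β Q (a • Q + P)) : ¬ IsNormal L α β g := by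
  rintro ⟨-, hdom, hnorm⟩
  obtain ⟨Z, hZ⟩ := (hdom P).1 ⟨_, hP⟩
  have h1 := hnorm P _ Z hP hZ
  have hPZ := hZ P _ hP
  have hQZ := hZ Q _ hQ
  have hself : ∀ X, ((g X X).re : ℂ) = g X X := fun X => by
    rw [← Complex.conj_eq_iff_re]
    exact hg.conj_symm X X
  have hnonneg : ∀ X, 0 ≤ (g X X).re := fun X => by
    rcases eq_or_ne X 0 with rfl | h
    · have := hg.smul_right 0 (0 : phaseSpace φ μ i) 0
      simp only [smul_zero, zero_mul] at this
      rw [this]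
      simp
    · exact (hg.pos X h).le
  have smul_left : ∀ (c : ℂ) X Y, g (c • X) Y = (starRingEnd ℂ) c * g X Y := fun c X Y => by
    rw [← hg.conj_symm, hg.smul_right, map_mul, hg.conj_symm]
  have add_left : ∀ X Y W, g (X + Y) W = g X W + g Y W := fun X Y W => by
    rw [← hg.conj_symm, hg.add_right, map_add, hg.conj_symm, hg.conj_symm]
  have h2 : g (a • P) (a • P) = g Z Z := by
    have := (Real.sqrt_inj (hnonneg _) (hnonneg _)).1 h1
    rw [← hself (a • P), ← hself Z, this]
  rw [hg.smul_right] at hPZ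
  set b := (starRingEnd ℂ) a with hb
  have hba : (starRingEnd ℂ) b = a := by rw [hb, Complex.conj_conj]
  have hZP : g P Z = b * g P P := by
    rw [← hg.conj_symm, ← hPZ, map_mul, hg.conj_symm]
  -- Equality of the norms of `A P` and `A* P` gives `‖A* P - ā P‖ = 0`. Pairing `A* P = ā P` with
  -- `Q` then yields `⟨P, P⟩ = 0`.
  have h3 : Z + (-b) • P = 0 := by
    by_contra hne
    have hpos := hg.pos _ hne
    have : g (Z + (-b) • P) (Z + (-b) • P) = 0 := by
      rw [add_left, hg.add_right, hg.add_right, hg.smul_right, hg.smul_right, smul_left, smul_left,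
        ← hPZ, hZP, ← h2, hg.smul_right, smul_left, map_neg, hba, ← hb]
      ring
    rw [this] at hpos
    simp at hpos
  have h4 : Z = b • P := by linear_combination (norm := module) h3
  rw [h4, smul_left, hba, hg.add_right, hg.smul_right] at hQZ
  have h5 : g P P = 0 := by linear_combination hQZ
  have := hg.pos P hP0
  rw [h5] at this
  simp at this

end MGT

/-! ### Assembling the blocks -/

namespace MGT

variable {H : Type*} [NormedAddCommGroup H] [InnerProductSpace ℂ H]
  {φ : HilbertBasis ℕ ℂ H} {μ : ℕ → ℝ} {L : H →ₗ.[ℂ] H} {α β : ℝ}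

theorem exists_pos_lower_bound (hpos : ∀ n, 0 < μ n) (hμ : Tendsto μ cofinite atTop) :
    ∃ m₀ > 0, ∀ n, m₀ ≤ μ n := by
  have hfin : {n | ¬ 1 ≤ μ n}.Finite := hμ.eventually_ge_atTop 1
  have h0 : 0 ≤ ∑ k ∈ hfin.toFinset, (μ k)⁻¹ :=
    Finset.sum_nonneg fun k _ => (inv_pos.2 (hpos k)).le
  refine ⟨(1 + ∑ k ∈ hfin.toFinset, (μ k)⁻¹)⁻¹, by positivity, fun n => ?_⟩
  rw [inv_le_comm₀ (by positivity) (hpos n)]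
  by_cases hn : 1 ≤ μ n
  · have := inv_le_one_of_one_le₀ hn
    linarith
  · have := Finset.single_le_sum (f := fun k => (μ k)⁻¹) (fun k _ => (inv_pos.2 (hpos k)).le)
      (hfin.mem_toFinset.2 hn)
    linarith

/-- Block matrices that agree with `C⁻¹` for large `n` are uniform. -/
theorem isUniform_of_eventually_eq (hα : 0 < α) (hβ : 0 < β) (hpos : ∀ n, 0 < μ n)
    (hμ : Tendsto μ cofinite atTop) (i : Fin 4) {S : ℕ → Matrix (Fin 3) (Fin 3) ℂ}
    (hdet : ∀ n, IsUnit (S n).det)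
    (hS : ∀ n, vandermonde α β (μ n) ≠ 0 → S n = (eigMatrix α β i (μ n))⁻¹) :
    IsUniform i μ S := by
  obtain ⟨C, hC, M, hM⟩ := exists_eigMatrix_inv_bound hα hβ i
  refine IsUniform.of_eventually hpos hdet (c := 1 / 9) (by norm_num) hC ?_
  have hev : ∀ᶠ n in cofinite, vandermonde α β (μ n) ≠ 0 := by
    filter_upwards [hμ.eventually_gt_atTop (m₁ α β).re, hμ.eventually_gt_atTop (m₂ α β).re]
      with n h1 h2
    rw [ne_eq, vandermonde_eq_zero_iff hα hβ (hpos n)]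
    rintro (h | h)
    · rw [← h, Complex.ofReal_re] at h1
      exact lt_irrefl _ h1
    · rw [← h, Complex.ofReal_re] at h2
      exact lt_irrefl _ h2
  filter_upwards [hev, hμ.eventually_ge_atTop M] with n hV hn x
  rw [hS n hV]
  refine ⟨?_, hM _ hn x⟩
  have := weightedSq_le_of_eigMatrix (hpos n) hV i x
  linarith

theorem nonExceptional_iff (hα : 0 < α) (hβ : 0 < β) (hpos : ∀ n, 0 < μ n) :
    NonExceptional μ α β ↔ ∀ n, vandermonde α β (μ n) ≠ 0 := by
  refine forall_congr' fun n => ?_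
  rw [ne_eq, ne_eq, ne_eq, vandermonde_eq_zero_iff hα hβ (hpos n), not_or]

theorem exists_genRel_jordan_chain [CompleteSpace H] (hφ : IsEigenbasis L φ μ)
    (hself : IsSelfAdjoint L) (hα : α ≠ 0) {m₀ : ℝ} (hm₀ : 0 < m₀) (hμ : ∀ n, m₀ ≤ μ n)
    (i : Fin 4) {n : ℕ} (hV : vandermonde α β (μ n) = 0) :
    ∃ (a : ℂ) (P Q : phaseSpace φ μ i), P ≠ 0 ∧ GenRel L α β P (a • P) ∧
      GenRel L α β Q (a • Q + P) := by
  obtain ⟨a, p, q, hp0, hp, hq⟩ := exists_jordan_chain hα hV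
  obtain ⟨P, hP⟩ := exists_mode φ hm₀ hμ i n p
  obtain ⟨Q, hQ⟩ := exists_mode φ hm₀ hμ i n q
  refine ⟨a, P, Q, ?_, ?_, ?_⟩
  · rintro rfl
    refine hp0 ?_
    have := hP n
    rw [if_pos rfl] at this
    rw [← this]
    ext r
    simp [coord, comp]
  · rw [genRel_iff hφ hself hα]
    intro k
    rw [coord_smul, hP]
    split_ifs with hk
    · rw [hk, hp]
    · simp
  · rw [genRel_iff hφ hself hα]
    intro k
    rw [coord_add, coord_smul, hP, hQ]
    split_ifs with hk
    · rw [hk, hq]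
    · simp

end MGT

theorem theorem2 {H : Type*} [NormedAddCommGroup H] [InnerProductSpace ℂ H] [CompleteSpace H]
    (hdim : ¬ FiniteDimensional ℂ H)
    (L : H →ₗ.[ℂ] H) (hself : IsSelfAdjoint L) (hpos : MGT.IsStrictlyPositive L)
    (hres : MGT.HasCompactResolvent L)
    (α β : ℝ) (hα : 0 < α) (hαβ : α < β) :
    (∃ (φ : HilbertBasis ℕ ℂ H) (μ : ℕ → ℝ), MGT.IsEigenbasis L φ μ) ∧
    ∀ (φ : HilbertBasis ℕ ℂ H) (μ : ℕ → ℝ), MGT.IsEigenbasis L φ μ →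
      (IsLUB (MGT.realParts μ α β) (MGT.sigmaMax μ α β) ∧ MGT.sigmaMax μ α β < 0) ∧
      (∀ i : Fin 4,
        (MGT.NonExceptional μ α β →
          MGT.IsScalarProduct (MGT.prodG (φ := φ) (μ := μ) (i := i) α β) ∧
          MGT.IsEquivalent (MGT.prodG (φ := φ) (μ := μ) (i := i) α β) ∧
          MGT.IsNormal L α β (MGT.prodG (φ := φ) (μ := μ) (i := i) α β) ∧
          MGT.DecayEstimate L α β (MGT.prodG (φ := φ) (μ := μ) (i := i) α β) ∧
          MGT.DecayOptimal L α β (MGT.prodG (φ := φ) (μ := μ) (i := i) α β)) ∧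
        (¬ MGT.NonExceptional μ α β →
          (¬ ∃ g : MGT.phaseSpace φ μ i → MGT.phaseSpace φ μ i → ℂ,
            MGT.IsScalarProduct g ∧ MGT.IsNormal L α β g) ∧
          ∃ g : MGT.phaseSpace φ μ i → MGT.phaseSpace φ μ i → ℂ,
            MGT.IsScalarProduct g ∧ MGT.IsEquivalent g ∧
            MGT.DecayEstimate L α β g ∧ MGT.DecayOptimal L α β g)) := by
  refine ⟨MGT.exists_eigenbasis hdim hself hpos hres, fun φ μ hφ => ?_⟩
  have hβ : 0 < β := hα.trans hαβ
  have hμpos : ∀ n, 0 < μ n := hφ.pos hpos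
  have hμtop : Tendsto μ cofinite atTop :=
    (hφ.tendsto hres).congr fun n => abs_of_pos (hμpos n)
  obtain ⟨m₀, hm₀, hμ⟩ := MGT.exists_pos_lower_bound hμpos hμtop
  have hLUB := MGT.sigmaMax_isLUB hα hαβ hm₀ hμ
  refine ⟨⟨hLUB, MGT.sigmaMax_neg hα hαβ hm₀ hμ⟩, fun i => ⟨fun hne => ?_, fun hex => ?_⟩⟩
  · rw [MGT.nonExceptional_iff hα hβ hμpos] at hne
    have hdet : ∀ n, IsUnit (MGT.eigMatrix α β i (μ n))⁻¹.det := fun n =>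
      Matrix.isUnit_nonsing_inv_det _ (MGT.isUnit_det_eigMatrix (hμpos n) (hne n) i)
    have hU := MGT.isUniform_of_eventually_eq hα hβ hμpos hμtop i hdet fun _ _ => rfl
    have hSM := fun n => MGT.eigMatrix_inv_mul_genMatrix hα.ne' (hμpos n) (hne n) i
    have hsp := hU.isScalarProduct (φ := φ) hμpos
    rw [MGT.prodG_eq_blockProd]
    exact ⟨hsp, hU.isEquivalent hμpos,
      MGT.isNormal_blockProd hU hdet hφ hself hα.ne' hm₀ hμ hSM,
      hU.decayEstimate hφ hself hα.ne' hm₀ hμ hSM fun n =>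
        MGT.diagonal_dissipative fun j => hLUB.1 (MGT.charRoot_re_mem hα n j),
      hsp.decayOptimal hφ hself hα.ne' hm₀ hμ hLUB⟩
  · rw [MGT.nonExceptional_iff hα hβ hμpos] at hex
    push Not at hex
    obtain ⟨n₀, hn₀⟩ := hex
    constructor
    · rintro ⟨g, hg, hnormal⟩
      obtain ⟨a, P, Q, hP0, hP, hQ⟩ :=
        MGT.exists_genRel_jordan_chain hφ hself hα.ne' hm₀ hμ i hn₀
      exact hg.not_isNormal hP0 hP hQ hnormal
    · have hblock : ∀ n, ∃ S B : Matrix (Fin 3) (Fin 3) ℂ, IsUnit S.det ∧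
          S * MGT.genMatrix α β (μ n) = B * S ∧
          (∀ y, (star y ⬝ᵥ (B *ᵥ y)).re ≤ MGT.sigmaMax μ α β * MGT.normSq₃ y) ∧
          (MGT.vandermonde α β (μ n) ≠ 0 → S = (MGT.eigMatrix α β i (μ n))⁻¹) := by
        intro n
        by_cases hV : MGT.vandermonde α β (μ n) = 0
        -- Only on an exceptional block is `C⁻¹` replaced; there all roots lie strictly below `-1/β
        -- ≤ σ_max`, which gives the required gap.
        · obtain ⟨S, B, h1, h2, h3⟩ := MGT.exists_dissipative_basis hα.ne' fun j =>
            (MGT.charRoot_re_lt_of_vandermonde_eq_zero hα hαβ (hμpos n) hV j).trans_le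
              (MGT.neg_inv_le_sigmaMax hα hαβ hLUB hμtop)
          exact ⟨S, B, h1, h2, h3, fun h => absurd hV h⟩
        · exact ⟨_, _, Matrix.isUnit_nonsing_inv_det _ (MGT.isUnit_det_eigMatrix (hμpos n) hV i),
            MGT.eigMatrix_inv_mul_genMatrix hα.ne' (hμpos n) hV i,
            MGT.diagonal_dissipative fun j => hLUB.1 (MGT.charRoot_re_mem hα n j), fun _ => rfl⟩
      choose S B hdet hSM hB hS using hblock
      have hU := MGT.isUniform_of_eventually_eq hα hβ hμpos hμtop i hdet hS
      have hsp := hU.isScalarProduct (φ := φ) hμpos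
      exact ⟨MGT.blockProd S, hsp, hU.isEquivalent hμpos,
        hU.decayEstimate hφ hself hα.ne' hm₀ hμ hSM hB,
        hsp.decayOptimal hφ hself hα.ne' hm₀ hμ hLUB⟩
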